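/- Let $(E_n,\mathscr E_n)_{n\ge 0}$ be measurable spaces, $\eta_0$ a probability measure on $E_0$ and $d\ge 0$. For $n\ge 0$ and $\xi\in\mathbb R^d$ let $M_{n+1,\xi}$ be a Markov kernel from $E_n$ to $E_{n+1}$ and $G_{n,\xi}:E_n\to(0,\infty)$ a measurable function; let $\xi_{n+1}:E_n\to\mathbb R^d$ be measurable, and let $\mathrm{Dom}(\xi_{n+1})\subset\mathbb R^d$ be a convex set containing the range of $\xi_{n+1}$. Write $Q_{n+1,\xi}\phi(x)=G_{n,\xi}(x)\int\phi(y)\,M_{n+1,\xi}(x,dy)$, and $\mu(\phi)=\int\phi\,d\mu$. *Limiting flow.* Recursively in $n$, with $G_n=G_{n,\eta_n(\xi_{n+1})}$, $M_{n+1}=M_{n+1,\eta_n(\xi_{n+1})}$, $Q_{n+1}=Q_{n+1,\eta_n(\xi_{n+1})}$, put $\gamma_n(\phi)=\mathbb E[\prod_{p=0}^{n-1}G_p(X_p)\,\phi(X_n)]$ and $\eta_n=\gamma_n/\gamma_n(1)$, where $(X_n)$ is the Markov chain with $X_0\sim\eta_0$ and transitions $M_n$. *Algorithm.* For each $N$,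 let $(x_n^i)_{n\ge0,\,1\le i\le N}$ be random variables such that $x_0^1,\dots,x_0^N$ are i.i.d. of law $\eta_0$ and, conditionally on all particles up to time $n$, the particles $x_{n+1}^1,\dots,x_{n+1}^N$ are i.i.d. of law $\eta_n^N(G_{n,N}M_{n+1,N})/\eta_n^N(G_{n,N})$, where $\eta_n^N=\frac1N\sum_{i=1}^N\delta_{x_n^i}$, $G_{n,N}=G_{n,\eta_n^N(\xi_{n+1})}$ and $M_{n+1,N}=M_{n+1,\eta_n^N(\xi_{n+1})}$. (The systems for different $N$ may live on different probability spaces.) *Assumptions.* Say that $f(x,\xi)$ is continuous at $\xi_*$ uniformly in $x$ if $\sup_x|f(x,\xi)-f(x,\xi_*)|\to0$ as $\xi\to\xi_*$. (A1) For each $n\ge0$: $\xi_{n+1}$ is bounded; $(x,\xi)\mapsto G_{n,\xi}(x)$ and, for each bounded measurable $\phi:E_{n+1}\to\mathbb R$, $(x,\xi)\mapsto Q_{n+1,\xi}\phi(x)$ are bounded on $E_n\times\mathbb R^d$ and continuous at $\xi=\eta_n(\xi_{n+1})$ uniformly in $x\in E_n$. (A2) For each $n\ge0$ and each bounded measurable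 $\phi:E_{n+1}\to\mathbb R$: $\xi\mapsto Q_{n+1,\xi}\phi(x)$ is differentiable at every $\xi\in\mathrm{Dom}(\xi_{n+1})$ for every $x\in E_n$, and $(x,\xi)\mapsto\partial_\xi Q_{n+1,\xi}\phi(x)$ is bounded on $E_n\times\mathrm{Dom}(\xi_{n+1})$ and, on this set, continuous at $\xi=\eta_n(\xi_{n+1})$ uniformly in $x$. *Notation.* For a probability measure $\mu$ and a bounded measurable $\mathbb R^r$-valued $\phi$, $\Sigma_\mu(\phi)=\int[\phi-\mu(\phi)][\phi-\mu(\phi)]^\top d\mu$. For $n\ge1$, $\mathscr L_n\phi=\eta_{n-1}[\partial_\xi Q_n\phi]\,(\xi_n-\eta_{n-1}(\xi_n))+Q_n\phi$, where $\partial_\xi Q_n\phi$ is $\partial_\xi Q_{n,\xi}\phi$ at $\xi=\eta_{n-1}(\xi_n)$; $\mathscr L_{p,n}=\mathscr L_{p+1}\circ\cdots\circ\mathscr L_n$ and $\mathscr L_{n,n}=\mathrm{Id}$. **Theorem.** Assume (A1) and (A2), and let $r\ge 1$. For every $n\ge 0$ and every bounded measurable $\phi_n:E_n\to\mathbb R^r$,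 $\sqrt N\,[\eta_n^N-\eta_n](\phi_n)$ converges weakly, as $N\to\infty$, to a centred Gaussian distribution on $\mathbb R^r$ with covariance matrix $$\Sigma_n(\phi_n)=\sum_{p=0}^n\frac{\gamma_p(1)^2}{\gamma_n(1)^2}\,\Sigma_{\eta_p}\big[\mathscr L_{p,n}(\phi_n-\eta_n(\phi_n))\big].$$ Moreover, for every $n\ge1$ and every bounded measurable $\phi_n:E_n\to\mathbb R^r$, $$\Sigma_n(\phi_n)=\Sigma_{\eta_n}(\phi_n)+\frac{\Sigma_{n-1}\big[\mathscr L_n(\phi_n-\eta_n(\phi_n))\big]}{\eta_{n-1}(G_{n-1})^2}.$$ -/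

import Mathlib

open MeasureTheory ProbabilityTheory Filter Topology
open scoped ENNReal

noncomputable section

/-- A bounded measurable function. -/
def BddMeas {α F : Type*} [MeasurableSpace α] [NormedAddCommGroup F] [MeasurableSpace F]
    (φ : α → F) : Prop :=
  Measurable φ ∧ ∃ C : ℝ, ∀ x, ‖φ x‖ ≤ C

/-- The function `f : 𝒳 × D → 𝒵` is continuous at `y₀`, uniformly on `𝒳`
(the second variable ranges over the metric subspace `D`). -/
def ContinuousAtUnif {X Y Z : Type*} [PseudoMetricSpace Y] [PseudoMetricSpace Z]
    (f : X → Y → Z) (D : Set Y) (y₀ : Y) : Prop :=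
  ∀ ε > 0, ∃ δ > 0, ∀ x, ∀ y ∈ D, dist y y₀ < δ → dist (f x y) (f x y₀) < ε

/-- The covariance matrix `Σ_μ(φ) = ∫ [φ - μ(φ)] ⊗ [φ - μ(φ)] dμ`. -/
def covMatrix {α : Type*} [MeasurableSpace α] {r : ℕ} (μ : Measure α)
    (φ : α → EuclideanSpace ℝ (Fin r)) : Matrix (Fin r) (Fin r) ℝ :=
  Matrix.of fun i j => ∫ x, (φ x - ∫ y, φ y ∂μ) i * (φ x - ∫ y, φ y ∂μ) j ∂μ

/-- The empirical measure of `N` points. -/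
def empirical {α : Type*} [MeasurableSpace α] {N : ℕ} (x : Fin N → α) : Measure α :=
  (N : ℝ≥0∞)⁻¹ • ∑ i, Measure.dirac (x i)

/-- The data of an adaptive SMC algorithm on the state spaces `E 0, E 1, …` with a `d`-dimensional
adaptation parameter. `M n ξ` is the Markov kernel `M_{n+1,ξ}` from `E n` to `E (n+1)`,
`G n ξ` is the strictly positive potential `G_{n,ξ}` on `E n`, and
`stat n` is the summary statistic `ξ_{n+1} : E n → ℝ^d`. -/
structure AdaptiveSMC (d : ℕ) (E : ℕ → Type*) [∀ n, MeasurableSpace (E n)] where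
  η₀ : Measure (E 0)
  M : ∀ n, EuclideanSpace ℝ (Fin d) → Kernel (E n) (E (n + 1))
  G : ∀ n, EuclideanSpace ℝ (Fin d) → E n → ℝ
  stat : ∀ n, E n → EuclideanSpace ℝ (Fin d)
  isProb : IsProbabilityMeasure η₀
  isMarkov : ∀ n ξ, IsMarkovKernel (M n ξ)
  measurable_G : ∀ n ξ, Measurable (G n ξ)
  G_pos : ∀ n ξ x, 0 < G n ξ x
  measurable_stat : ∀ n, Measurable (stat n)

namespace AdaptiveSMC

variable {d : ℕ} {E : ℕ → Type*} [∀ n, MeasurableSpace (E n)]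

instance instProb (S : AdaptiveSMC d E) : IsProbabilityMeasure S.η₀ := S.isProb

instance instMarkov (S : AdaptiveSMC d E) (n : ℕ) (ξ : EuclideanSpace ℝ (Fin d)) :
    IsMarkovKernel (S.M n ξ) := S.isMarkov n ξ

/-! ### The limiting flow -/

/-- Transition kernel of the chain, from the whole past to the next state, when the parameter used
at the step from `n` to `n+1` is `θ n`; it only looks at the present state. -/
def step (S : AdaptiveSMC d E) (θ : ℕ → EuclideanSpace ℝ (Fin d)) (n : ℕ) :
    Kernel (Π i : Finset.Iic n, E i) (E (n + 1)) :=
  (S.M n (θ n)).comap (fun x => x ⟨n, Finset.mem_Iic.2 le_rfl⟩) (measurable_pi_apply _)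

instance instStep (S : AdaptiveSMC d E) (θ : ℕ → EuclideanSpace ℝ (Fin d)) (n : ℕ) :
    IsMarkovKernel (S.step θ n) := by
  unfold step; infer_instance

/-- Law of the non-homogeneous Markov chain `(X_n)` with `X_0 ∼ η₀` and transitions
`M_{n+1, θ n}`. -/
def chainLaw (S : AdaptiveSMC d E) (θ : ℕ → EuclideanSpace ℝ (Fin d)) : Measure (Π n, E n) :=
  Kernel.trajMeasure S.η₀ (S.step θ)

/-- The unnormalised measure `φ ↦ 𝔼[∏_{p<n} G_{p, θ p}(X_p) φ(X_n)]`. -/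
def gammaOf (S : AdaptiveSMC d E) (θ : ℕ → EuclideanSpace ℝ (Fin d)) (n : ℕ) : Measure (E n) :=
  ((S.chainLaw θ).withDensity
    (fun x => ∏ p ∈ Finset.range n, ENNReal.ofReal (S.G p (θ p) (x p)))).map (fun x => x n)

/-- The normalised measure associated with `gammaOf`. -/
def etaOf (S : AdaptiveSMC d E) (θ : ℕ → EuclideanSpace ℝ (Fin d)) (n : ℕ) : Measure (E n) :=
  (S.gammaOf θ n Set.univ)⁻¹ • S.gammaOf θ n

/-- The limiting parameters `η_n(ξ_{n+1})`, by recursion on `n`: the measure `η_n` is built from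
the parameters of index `< n` only (see `limitParam_eq` below). -/
def limitParam (S : AdaptiveSMC d E) (n : ℕ) : EuclideanSpace ℝ (Fin d) :=
  ∫ x, S.stat n x ∂(S.etaOf (fun p => if _h : p < n then S.limitParam p else 0) n)
termination_by n

/-- The unnormalised measure `γ_n`. -/
def gamma (S : AdaptiveSMC d E) (n : ℕ) : Measure (E n) := S.gammaOf S.limitParam n

/-- The target probability measure `η_n = γ_n / γ_n(1)`. -/
def eta (S : AdaptiveSMC d E) (n : ℕ) : Measure (E n) := S.etaOf S.limitParam n

/-- The limiting potential `G_n = G_{n, η_n(ξ_{n+1})}`. -/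
def limG (S : AdaptiveSMC d E) (n : ℕ) : E n → ℝ := S.G n (S.limitParam n)

lemma measurable_weight (S : AdaptiveSMC d E) (θ : ℕ → EuclideanSpace ℝ (Fin d)) (n : ℕ) :
    Measurable (fun x : Π n, E n =>
      ∏ p ∈ Finset.range n, ENNReal.ofReal (S.G p (θ p) (x p))) :=
  Finset.measurable_prod _ fun p _ =>
    ((S.measurable_G p (θ p)).comp (measurable_pi_apply p)).ennreal_ofReal

/-- The Feynman–Kac formula that defines `γ_n`. -/
theorem integral_gammaOf (S : AdaptiveSMC d E) (θ : ℕ → EuclideanSpace ℝ (Fin d)) (n : ℕ)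
    {φ : E n → ℝ} (hφ : Measurable φ) :
    ∫ x, φ x ∂(S.gammaOf θ n)
      = ∫ x, (∏ p ∈ Finset.range n, S.G p (θ p) (x p)) * φ (x n) ∂(S.chainLaw θ) := by
  rw [gammaOf, integral_map (measurable_pi_apply n).aemeasurable hφ.aestronglyMeasurable,
    integral_withDensity_eq_integral_toReal_smul (S.measurable_weight θ n)
      (ae_of_all _ fun x => ENNReal.prod_lt_top fun p _ => ENNReal.ofReal_lt_top)]
  refine integral_congr_ae (ae_of_all _ fun x => ?_)
  simp only [ENNReal.toReal_prod, smul_eq_mul]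
  congr 1
  exact Finset.prod_congr rfl fun p _ => ENNReal.toReal_ofReal (S.G_pos p _ _).le

/-- `γ_0 = η_0`. -/
theorem gammaOf_zero (S : AdaptiveSMC d E) (θ : ℕ → EuclideanSpace ℝ (Fin d)) :
    S.gammaOf θ 0 = S.η₀ := by
  have h1 : (S.chainLaw θ).map (Preorder.frestrictLe 0)
      = S.η₀.map (MeasurableEquiv.piUnique (fun i : Finset.Iic 0 => E i)).symm := by
    rw [chainLaw, Kernel.trajMeasure, Measure.map_comp _ _ (by fun_prop),
      Kernel.traj_map_frestrictLe, Kernel.partialTraj_self, Measure.id_comp]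
    rfl
  have h2 : (S.chainLaw θ).map (fun x => x 0)
      = ((S.chainLaw θ).map (Preorder.frestrictLe 0)).map
        (fun y => y ⟨0, Finset.mem_Iic.2 le_rfl⟩) := by
    rw [Measure.map_map (measurable_pi_apply _) (by fun_prop)]
    rfl
  have h3 : (fun y : Π i : Finset.Iic 0, E i => y ⟨0, Finset.mem_Iic.2 le_rfl⟩) ∘
      (MeasurableEquiv.piUnique (fun i : Finset.Iic 0 => E i)).symm = id := by
    funext x
    exact (MeasurableEquiv.piUnique (fun i : Finset.Iic 0 => E i)).apply_symm_apply x
  simp only [gammaOf, Finset.range_zero, Finset.prod_empty]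
  rw [show (fun _ : Π n, E n => (1 : ℝ≥0∞)) = 1 from rfl, withDensity_one, h2, h1]
  exact (Measure.map_map (measurable_pi_apply _) (MeasurableEquiv.measurable _)).trans <|
    (congrArg (fun f => S.η₀.map f) h3).trans Measure.map_id

/-- `γ_{n+1} = γ_n Q_{n+1}`. -/
theorem gammaOf_succ (S : AdaptiveSMC d E) (θ : ℕ → EuclideanSpace ℝ (Fin d)) (n : ℕ) :
    S.gammaOf θ (n + 1) = ((S.gammaOf θ n).withDensity
      (fun x => ENNReal.ofReal (S.G n (θ n) x))).bind (S.M n (θ n)) := by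
  ext B hB
  have hg : Measurable (fun x => ENNReal.ofReal (S.G n (θ n) x)) :=
    (S.measurable_G n (θ n)).ennreal_ofReal
  have hM : Measurable (fun x => S.M n (θ n) x B) := Kernel.measurable_coe _ hB
  have hw : Measurable (fun y : Π i : Finset.Iic n, E i =>
      ∏ p : Finset.Iic n, ENNReal.ofReal (S.G p (θ p) (y p))) :=
    Finset.measurable_prod _ fun p _ =>
      ((S.measurable_G p (θ p)).comp (measurable_pi_apply p)).ennreal_ofReal
  have hprod : ∀ x : Π n, E n,
      ∏ p ∈ Finset.range (n + 1), ENNReal.ofReal (S.G p (θ p) (x p))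
        = ∏ p : Finset.Iic n, ENNReal.ofReal (S.G p (θ p) (Preorder.frestrictLe n x p)) := by
    intro x
    rw [Nat.range_succ_eq_Iic, ← Finset.prod_coe_sort]
    rfl
  have hind : Measurable (fun b : E (n + 1) => B.indicator (1 : E (n + 1) → ℝ≥0∞) b) :=
    measurable_one.indicator hB
  have hm1 : Measurable (fun z : (Π i : Finset.Iic n, E i) × E (n + 1) =>
      (∏ p : Finset.Iic n, ENNReal.ofReal (S.G p (θ p) (z.1 p))) *
        B.indicator (1 : E (n + 1) → ℝ≥0∞) z.2) :=
    (hw.comp measurable_fst).mul (hind.comp measurable_snd)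
  have hm2 : Measurable (fun y : Π i : Finset.Iic n, E i =>
      (∏ p : Finset.Iic n, ENNReal.ofReal (S.G p (θ p) (y p))) * S.step θ n y B) :=
    hw.mul (Kernel.measurable_coe _ hB)
  have key := Kernel.map_frestrictLe_trajMeasure_compProd_eq_map_trajMeasure
    (μ₀ := S.η₀) (κ := S.step θ) (a := n)
  calc S.gammaOf θ (n + 1) B
      = ∫⁻ x, (∏ p : Finset.Iic n, ENNReal.ofReal (S.G p (θ p) (Preorder.frestrictLe n x p)))
          * B.indicator 1 (x (n + 1)) ∂(S.chainLaw θ) := by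
        rw [gammaOf, Measure.map_apply (measurable_pi_apply _) hB,
          withDensity_apply _ (measurable_pi_apply _ hB),
          ← lintegral_indicator (measurable_pi_apply _ hB)]
        refine lintegral_congr fun x => ?_
        rw [← hprod]
        by_cases hx : x (n + 1) ∈ B <;> simp [hx]
    _ = ∫⁻ z, (∏ p : Finset.Iic n, ENNReal.ofReal (S.G p (θ p) (z.1 p)))
          * B.indicator 1 z.2 ∂((S.chainLaw θ).map
            (fun x => (Preorder.frestrictLe n x, x (n + 1)))) := by
        rw [lintegral_map hm1 (by fun_prop)]
    _ = ∫⁻ y, (∏ p : Finset.Iic n, ENNReal.ofReal (S.G p (θ p) (y p)))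
          * S.step θ n y B ∂((S.chainLaw θ).map (Preorder.frestrictLe n)) := by
        rw [chainLaw, ← key, Measure.lintegral_compProd hm1]
        refine lintegral_congr fun y => ?_
        have h := lintegral_const_mul (μ := S.step θ n y)
          (∏ p : Finset.Iic n, ENNReal.ofReal (S.G p (θ p) (y p))) hind
        rw [lintegral_indicator_one hB] at h
        exact h
    _ = ∫⁻ x, (∏ p ∈ Finset.range n, ENNReal.ofReal (S.G p (θ p) (x p))) *
          (ENNReal.ofReal (S.G n (θ n) (x n)) * S.M n (θ n) (x n) B) ∂(S.chainLaw θ) := by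
        rw [lintegral_map hm2 (by fun_prop)]
        refine lintegral_congr fun x => ?_
        rw [← hprod, Finset.prod_range_succ, mul_assoc]
        rfl
    _ = _ := by
        rw [Measure.bind_apply hB (Kernel.aemeasurable _),
          lintegral_withDensity_eq_lintegral_mul _ hg hM, gammaOf,
          lintegral_map (hg.mul hM) (measurable_pi_apply n)]
        exact (lintegral_withDensity_eq_lintegral_mul _ (S.measurable_weight θ n)
          ((hg.mul hM).comp (measurable_pi_apply n))).symm

lemma gammaOf_congr (S : AdaptiveSMC d E) {θ θ' : ℕ → EuclideanSpace ℝ (Fin d)} (n : ℕ)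
    (h : ∀ p < n, θ p = θ' p) : S.gammaOf θ n = S.gammaOf θ' n := by
  induction n with
  | zero => rw [gammaOf_zero, gammaOf_zero]
  | succ n ih =>
    rw [gammaOf_succ, gammaOf_succ, ih fun p hp => h p (by omega), h n (by omega)]

/-- The parameters used by the limiting flow are `η_n(ξ_{n+1})`. -/
theorem limitParam_eq (S : AdaptiveSMC d E) (n : ℕ) :
    S.limitParam n = ∫ x, S.stat n x ∂(S.eta n) := by
  rw [limitParam, eta, etaOf, etaOf, S.gammaOf_congr n]
  intro p hp
  simp [hp]

/-! ### The practical algorithm -/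

/-- `μ ↦ μ(G_{n,ξ} M_{n+1,ξ}) / μ(G_{n,ξ})`. -/
def Phi (S : AdaptiveSMC d E) (n : ℕ) (ξ : EuclideanSpace ℝ (Fin d)) (μ : Measure (E n)) :
    Measure (E (n + 1)) :=
  (∫⁻ x, ENNReal.ofReal (S.G n ξ x) ∂μ)⁻¹ •
    (μ.withDensity (fun x => ENNReal.ofReal (S.G n ξ x))).bind (S.M n ξ)

/-- `Φ_{n+1,N}(η_n^N)` for the particles `x`: the parameter is `η_n^N(ξ_{n+1})`. -/
def PhiN (S : AdaptiveSMC d E) (n : ℕ) {N : ℕ} (x : Fin N → E n) : Measure (E (n + 1)) :=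
  S.Phi n (∫ y, S.stat n y ∂(empirical x)) (empirical x)

/-- `X n i : Ω → E n` is the `i`-th particle at time `n` of the practical SMC algorithm with `N`
particles: the initial particles are i.i.d. of law `η₀` and, conditionally on the past up to
time `n`, the particles at time `n+1` are i.i.d. of law `Φ_{n+1,N}(η_n^N)`. -/
structure IsParticleSystem (S : AdaptiveSMC d E) (N : ℕ) {Ω : Type*} [MeasurableSpace Ω]
    (P : Measure Ω) (X : ∀ n, Fin N → Ω → E n) : Prop where
  measurable : ∀ n i, Measurable (X n i)
  init : P.map (fun ω i => X 0 i ω) = Measure.pi (fun _ : Fin N => S.η₀)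
  step : ∀ n, ∀ A : Set Ω,
    MeasurableSet[⨆ (p : ℕ) (_ : p ≤ n) (i : Fin N), MeasurableSpace.comap (X p i) inferInstance] A →
    ∀ B : Fin N → Set (E (n + 1)), (∀ i, MeasurableSet (B i)) →
      P (A ∩ {ω | ∀ i, X (n + 1) i ω ∈ B i})
        = ∫⁻ ω in A, ∏ i, S.PhiN n (fun j => X n j ω) (B i) ∂P

/-! ### Assumptions and asymptotic covariance -/

/-- `Q_{n+1,ξ} φ (x) = G_{n,ξ}(x) ∫ φ(y) M_{n+1,ξ}(x, dy)`. -/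
def Q {F : Type*} [NormedAddCommGroup F] [NormedSpace ℝ F] (S : AdaptiveSMC d E) (n : ℕ)
    (ξ : EuclideanSpace ℝ (Fin d)) (φ : E (n + 1) → F) (x : E n) : F :=
  S.G n ξ x • ∫ y, φ y ∂(S.M n ξ x)

/-- The derivative `∂_ξ Q_{n+1,ξ} φ (x)`. -/
def dQ {F : Type*} [NormedAddCommGroup F] [NormedSpace ℝ F] (S : AdaptiveSMC d E) (n : ℕ)
    (ξ : EuclideanSpace ℝ (Fin d)) (φ : E (n + 1) → F) (x : E n) :
    EuclideanSpace ℝ (Fin d) →L[ℝ] F :=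
  fderiv ℝ (fun ζ => S.Q n ζ φ x) ξ

/-- Boundedness and continuity assumption: the statistics are bounded, and the functions
`(x, ξ) ↦ G_{n,ξ}(x)` and `(x, ξ) ↦ Q_{n+1,ξ} φ (x)`, for every bounded measurable `φ`, are bounded
on `E_n × ℝ^d` and continuous at `ξ = η_n(ξ_{n+1})` uniformly in `x`. -/
structure HypContinuity (S : AdaptiveSMC d E) : Prop where
  G_bdd : ∀ n, ∃ C : ℝ, ∀ x ξ, |S.G n ξ x| ≤ C
  G_cont : ∀ n, ContinuousAtUnif (fun x ξ => S.G n ξ x) Set.univ (S.limitParam n)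
  stat_bdd : ∀ n, ∃ C : ℝ, ∀ x, ‖S.stat n x‖ ≤ C
  Q_bdd : ∀ n, ∀ φ : E (n + 1) → ℝ, BddMeas φ → ∃ C : ℝ, ∀ x ξ, |S.Q n ξ φ x| ≤ C
  Q_cont : ∀ n, ∀ φ : E (n + 1) → ℝ, BddMeas φ →
    ContinuousAtUnif (fun x ξ => S.Q n ξ φ x) Set.univ (S.limitParam n)

/-- Differentiability assumption, where `Dom n` is the set `Dom(ξ_{n+1})`: for every bounded
measurable `φ`, the derivative `∂_ξ Q_{n+1,ξ} φ (x)` exists and is bounded on `E_n × Dom(ξ_{n+1})`,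
and it is continuous at `ξ = η_n(ξ_{n+1})` uniformly in `x`. -/
structure HypDifferentiability (S : AdaptiveSMC d E) (Dom : ℕ → Set (EuclideanSpace ℝ (Fin d))) : Prop where
  diff : ∀ n, ∀ φ : E (n + 1) → ℝ, BddMeas φ → ∀ x, ∀ ξ ∈ Dom n,
    DifferentiableAt ℝ (fun ζ => S.Q n ζ φ x) ξ
  bdd : ∀ n, ∀ φ : E (n + 1) → ℝ, BddMeas φ → ∃ C : ℝ, ∀ x, ∀ ξ ∈ Dom n, ‖S.dQ n ξ φ x‖ ≤ C
  cont : ∀ n, ∀ φ : E (n + 1) → ℝ, BddMeas φ →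
    ContinuousAtUnif (fun x ξ => S.dQ n ξ φ x) (Dom n) (S.limitParam n)

/-- The operator `𝓛_{n+1}`:
`𝓛_{n+1} φ = η_n[∂_ξ Q_{n+1} φ] (ξ_{n+1} - η_n(ξ_{n+1})) + Q_{n+1} φ`. -/
def L {F : Type*} [NormedAddCommGroup F] [NormedSpace ℝ F] (S : AdaptiveSMC d E) (n : ℕ)
    (φ : E (n + 1) → F) (x : E n) : F :=
  (∫ z, S.dQ n (S.limitParam n) φ z ∂(S.eta n)) (S.stat n x - ∫ z, S.stat n z ∂(S.eta n))
    + S.Q n (S.limitParam n) φ x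

/-- The operator `𝓛_{p,n} = 𝓛_{p+1} ∘ ⋯ ∘ 𝓛_n`, with `𝓛_{n,n} = Id`. -/
def Lcomp {F : Type*} [NormedAddCommGroup F] [NormedSpace ℝ F] (S : AdaptiveSMC d E) {p n : ℕ}
    (h : p ≤ n) (φ : E n → F) : E p → F :=
  Nat.decreasingInduction (motive := fun k _ => E k → F) (fun k _ ψ => S.L k ψ) φ h

/-- The asymptotic covariance
`Σ_n(φ) = ∑_{p ≤ n} γ_p(1)² / γ_n(1)² Σ_{η_p}[𝓛_{p,n}(φ - η_n(φ))]`. -/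
def asympCov {r : ℕ} (S : AdaptiveSMC d E) (n : ℕ) (φ : E n → EuclideanSpace ℝ (Fin r)) :
    Matrix (Fin r) (Fin r) ℝ :=
  ∑ p : Fin (n + 1),
    ((S.gamma p).real Set.univ ^ 2 / (S.gamma n).real Set.univ ^ 2) •
      covMatrix (S.eta p)
        (S.Lcomp (Nat.lt_succ_iff.1 p.2) (fun x => φ x - ∫ y, φ y ∂(S.eta n)))

end AdaptiveSMC

end

/-! Conditionally on the particles at time `n`, those at time `n + 1` are i.i.d. of the random law
`PhiN`. For a real `φ` with `η_{n+1}(φ) = 0`, the conditional characteristic function of `√N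
η_{n+1}^N(φ)` is therefore an `N`-th power. `norm_integral_cexp_pow_sub_le`, whose error depends on
the law only through a bound for `φ`, replaces it by `exp(i √N p) exp(-V'/2)` at a cost `O(1/√N)`,
where `p` and `V'` are the mean and the variance of `φ` under `PhiN`.

The variance `V'` tends to `V = η_{n+1}(φ²)`. The mean `p` is linearized in `exists_PhiN_sub_L`: it
equals `η_n^N(ψ)` up to `o(1/√N)`, with `ψ = 𝓛_{n+1} φ / η_n(G_n)`. Adaptation matters only there.
The random parameter is itself an empirical mean, so its first-order effect is the empirical mean of
a fixed function, the derivative term of `𝓛`. Thus the characteristic function for `φ` at time `n +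
1` is that for `ψ` at time `n` times `exp(-V/2)`, up to `o(1)`, and induction gives a Gaussian limit
of variance `asympVar`.

All errors are measured in mean. By `IsParticleLaw.meanSquareRate`, empirical means of bounded
functions fluctuate by `O(1/√N)` in mean square, so a product of two fluctuations has mean `O(1/N)`
and survives multiplication by `√N`.

Vector-valued test functions reduce to real ones by Cramér–Wold, since `𝓛` commutes with linear
functionals (`L_clm_comp`); `dotProduct_asympCov_mulVec` matches `asympVar` with the stated
covariance through the recursion `asympCov_succ`. -/

noncomputable section

/-! ### Means of functions with values in a convex set -/

/-- A proper support functional at a point outside a convex set in finite dimension. -/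
lemma Convex.exists_ne_zero_le_of_notMem {V : Type*} [NormedAddCommGroup V] [NormedSpace ℝ V]
    [FiniteDimensional ℝ V] {s : Set V} (hs : Convex ℝ s) (hne : s.Nonempty)
    {m : V} (hm : m ∉ s) :
    ∃ f : V →L[ℝ] ℝ, f ≠ 0 ∧ ((∀ y ∈ s, f y ≤ f m) ∨ ∃ c, ∀ y ∈ s, f y = c) := by
  by_cases hi : (interior s).Nonempty
  · obtain ⟨f, hf⟩ := geometric_hahn_banach_open_point hs.interior isOpen_interior
      (fun h => hm (interior_subset h))
    refine ⟨f, ?_, Or.inl fun y hy => ?_⟩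
    · rintro rfl
      obtain ⟨y, hy⟩ := hi
      simpa using hf y hy
    · have h1 : closure (interior s) ⊆ {y | f y ≤ f m} :=
        closure_minimal (fun z hz => (hf z hz).le) (isClosed_le f.continuous continuous_const)
      exact h1 (by rw [hs.closure_interior_eq_closure_of_nonempty_interior hi]
                   exact subset_closure hy)
  -- With empty interior the affine span is proper, and a nonzero functional killing its direction
  -- is constant on `s`.
  · rw [hs.interior_nonempty_iff_affineSpan_eq_top] at hi
    obtain ⟨y₀, hy₀⟩ := hne
    have hd : (affineSpan ℝ s).direction ≠ ⊤ := by
      intro h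
      exact hi ((AffineSubspace.direction_eq_top_iff_of_nonempty
        ⟨y₀, subset_affineSpan ℝ s hy₀⟩).1 h)
    obtain ⟨f, hf0, hf⟩ := Submodule.exists_le_ker_of_lt_top _ (lt_top_iff_ne_top.2 hd)
    refine ⟨LinearMap.toContinuousLinearMap f, ?_, Or.inr ⟨f y₀, fun y hy => ?_⟩⟩
    · simpa using hf0
    · have h2 : y - y₀ ∈ (affineSpan ℝ s).direction := by
        have := AffineSubspace.vsub_mem_direction (subset_affineSpan ℝ s hy)
          (subset_affineSpan ℝ s hy₀)
        simpa using this
      have := hf h2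
      simp only [LinearMap.mem_ker, map_sub, sub_eq_zero] at this
      simpa using this

/-- A convex set of a finite-dimensional space, closed or not, contains the mean of any integrable
function with values in it. -/
theorem Convex.integral_mem_of_finiteDimensional {α : Type*} [MeasurableSpace α] {μ : Measure α}
    [IsProbabilityMeasure μ] {V : Type*} [NormedAddCommGroup V] [NormedSpace ℝ V]
    [FiniteDimensional ℝ V] {s : Set V} (hs : Convex ℝ s) {u : α → V}
    (hu : ∀ᵐ x ∂μ, u x ∈ s) (hi : Integrable u μ) : ∫ x, u x ∂μ ∈ s := by
  -- As `s` need not be closed, separation at `m` is only weak. But a functional that is at most `f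
  -- m` on `s`, or constant there, and has mean `f m`, equals `f m` almost everywhere. So `u - m`
  -- lives in the kernel of `f`, and the dimension drops.
  induction hk : Module.finrank ℝ V using Nat.strong_induction_on generalizing V with
  | _ k ih =>
  by_contra hm
  set m := ∫ x, u x ∂μ with hmdef
  have hne : s.Nonempty := by
    obtain ⟨x, hx⟩ := hu.exists
    exact ⟨_, hx⟩
  obtain ⟨f, hf0, hf⟩ := hs.exists_ne_zero_le_of_notMem hne hm
  have hfi : Integrable (fun x => f (u x)) μ := f.integrable_comp hi
  have hfm : ∫ x, f (u x) ∂μ = f m := f.integral_comp_comm hi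
  have hker : ∀ᵐ x ∂μ, f (u x) = f m := by
    rcases hf with hf | ⟨c, hc⟩
    · have h0 : 0 ≤ᵐ[μ] fun x => f m - f (u x) := by
        filter_upwards [hu] with x hx
        simpa using hf _ hx
      have h1 : ∫ x, (f m - f (u x)) ∂μ = 0 := by
        rw [integral_sub (integrable_const _) hfi, hfm]
        simp
      filter_upwards [(integral_eq_zero_iff_of_nonneg_ae h0
        ((integrable_const _).sub hfi)).1 h1] with x hx
      simp only [Pi.zero_apply] at hx
      linarith
    · have h1 : ∫ x, f (u x) ∂μ = c := by
        rw [integral_congr_ae (g := fun _ => c) (by filter_upwards [hu] with x hx using hc _ hx)]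
        simp
      filter_upwards [hu] with x hx
      rw [hc _ hx, ← hfm, h1]
  -- A projection onto the kernel turns `u - m`, which is kernel-valued only almost everywhere, into
  -- a function with values in the kernel as a type.
  obtain ⟨g, hg⟩ := LinearMap.exists_leftInverse_of_injective f.ker.subtype
    (by simp)
  have hg' : ∀ v : f.ker, g v = v := fun v => LinearMap.congr_fun hg v
  set gc := LinearMap.toContinuousLinearMap g
  have hlt : Module.finrank ℝ f.ker < k := by
    rw [← hk]
    refine Submodule.finrank_lt ?_
    intro h
    apply hf0
    ext v
    have : v ∈ f.ker := h ▸ Submodule.mem_top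
    simpa using this
  have hs' : Convex ℝ {v : f.ker | (v : V) + m ∈ s} := by
    intro v hv w hw a b ha hb hab
    have h := hs hv hw ha hb hab
    simp only [Set.mem_ofPred_eq, Submodule.coe_add, Submodule.coe_smul] at h ⊢
    convert h using 1
    have : m = a • m + b • m := by rw [← add_smul, hab, one_smul]
    nth_rewrite 1 [this]
    module
  have hmem := ih _ hlt hs' (u := fun x => gc (u x - m)) (by
      filter_upwards [hu, hker] with x hx hx'
      have h1 : u x - m ∈ f.ker := by simp [hx']
      have h2 : gc (u x - m) = ⟨u x - m, h1⟩ := hg' ⟨u x - m, h1⟩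
      simpa [h2] using hx)
    (gc.integrable_comp (hi.sub (integrable_const m))) rfl
  have h0 : ∫ x, gc (u x - m) ∂μ = gc (∫ x, (u x - m) ∂μ) :=
    gc.integral_comp_comm (hi.sub (integrable_const m))
  rw [h0, integral_sub hi (integrable_const m)] at hmem
  simp only [integral_const, probReal_univ, one_smul, ← hmdef, sub_self, map_zero,
    Set.mem_ofPred_eq, ZeroMemClass.coe_zero, zero_add] at hmem
  exact hm hmem

/-! ### Quantitative central limit theorem for bounded i.i.d. variables -/

/-- Comparison of powers of points in the unit disc. -/
lemma norm_pow_sub_pow_le_of_norm_le_one {a b : ℂ} (ha : ‖a‖ ≤ 1) (hb : ‖b‖ ≤ 1) (n : ℕ) :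
    ‖a ^ n - b ^ n‖ ≤ n * ‖a - b‖ := by
  induction n with
  | zero => simp
  | succ n ih =>
    have : a ^ (n + 1) - b ^ (n + 1) = a ^ n * (a - b) + (a ^ n - b ^ n) * b := by ring
    rw [this]
    refine (norm_add_le _ _).trans ?_
    rw [norm_mul, norm_mul, norm_pow]
    have h1 : ‖a‖ ^ n ≤ 1 := pow_le_one₀ (norm_nonneg _) ha
    have h2 := mul_le_mul_of_nonneg_right h1 (norm_nonneg (a - b))
    have h3 := mul_le_mul ih hb (norm_nonneg _) (by positivity)
    push_cast
    linarith

/-- The characteristic function of a bounded centred variable to second order. -/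
lemma norm_integral_cexp_sub_le {α : Type*} [MeasurableSpace α] {ν : Measure α}
    [IsProbabilityMeasure ν] {f : α → ℝ} (hf : Measurable f) {K δ : ℝ} (hK : ∀ x, |f x| ≤ K)
    (h0 : ∫ x, f x ∂ν = 0) (hδ : 0 ≤ δ) (hδ1 : δ ≤ 1) :
    ‖∫ x, Complex.exp (Complex.I * ↑(δ * f x)) ∂ν
      - Complex.exp (-((δ ^ 2 * ∫ x, f x ^ 2 ∂ν) / 2 : ℝ))‖ ≤
      δ ^ 3 * (K ^ 3 * Real.exp K + K ^ 4 * Real.exp (K ^ 2)) := by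
  have hK0 : 0 ≤ K := by
    obtain ⟨x⟩ := ν.nonempty_of_neZero
    exact (abs_nonneg _).trans (hK x)
  have hfi : Integrable f ν := Integrable.of_bound hf.aestronglyMeasurable K
    (ae_of_all _ fun x => by simpa using hK x)
  have hf2 : ∀ x, f x ^ 2 ≤ K ^ 2 := fun x => by
    rw [← sq_abs]
    exact pow_le_pow_left₀ (abs_nonneg _) (hK x) 2
  have hf2i : Integrable (fun x => f x ^ 2) ν := Integrable.of_bound
    (hf.pow_const 2).aestronglyMeasurable (K ^ 2)
    (ae_of_all _ fun x => by simpa using hf2 x)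
  set V := ∫ x, f x ^ 2 ∂ν with hV
  have hV0 : 0 ≤ V := integral_nonneg fun x => sq_nonneg _
  have hVK : V ≤ K ^ 2 := by
    have := integral_mono hf2i (integrable_const (K ^ 2)) hf2
    simpa using this
  have hexpi : Integrable (fun x => Complex.exp (Complex.I * ↑(δ * f x))) ν := by
    refine Integrable.of_bound (by fun_prop) 1 (ae_of_all _ fun x => ?_)
    rw [mul_comm, Complex.norm_exp_ofReal_mul_I]
  -- Both terms are compared with `1 - δ ^ 2 * V / 2`. It is the mean of the second-order Taylor
  -- polynomial, whose linear term is centred, and the first-order expansion of the Gaussian factor.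
  have hpoly : ∫ x, ((1 : ℂ) + Complex.I * ↑(δ * f x) + (Complex.I * ↑(δ * f x)) ^ 2 / 2) ∂ν
      = ((1 - δ ^ 2 * V / 2 : ℝ) : ℂ) := by
    have h1 : ∀ x, (1 : ℂ) + Complex.I * ↑(δ * f x) + (Complex.I * ↑(δ * f x)) ^ 2 / 2
        = ((1 - δ ^ 2 / 2 * f x ^ 2 : ℝ) : ℂ) + Complex.I * ((δ * f x : ℝ) : ℂ) := by
      intro x
      rw [mul_pow, Complex.I_sq]
      push_cast
      ring
    simp_rw [h1]
    rw [integral_add, integral_const_mul, integral_complex_ofReal, integral_complex_ofReal,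
      integral_const_mul, h0, integral_sub (integrable_const _) (hf2i.const_mul _),
      integral_const_mul]
    · simp
      ring
    · exact ((integrable_const _).sub (hf2i.const_mul _)).ofReal
    · exact ((hfi.const_mul _).ofReal).const_mul _
  have hpi : Integrable (fun x => (1 : ℂ) + Complex.I * ↑(δ * f x)
      + (Complex.I * ↑(δ * f x)) ^ 2 / 2) ν := by
    have h2 : Integrable (fun x => (Complex.I * ↑(δ * f x)) ^ 2 / 2) ν := by
      have : (fun x => (Complex.I * ↑(δ * f x)) ^ 2 / 2)
          = fun x => ((-(δ ^ 2 / 2) * f x ^ 2 : ℝ) : ℂ) := by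
        funext x
        rw [mul_pow, Complex.I_sq]
        push_cast
        ring
      rw [this]
      exact (hf2i.const_mul _).ofReal
    exact ((integrable_const _).add (((hfi.const_mul _).ofReal).const_mul _)).add h2
  have hA : ‖∫ x, Complex.exp (Complex.I * ↑(δ * f x)) ∂ν - ((1 - δ ^ 2 * V / 2 : ℝ) : ℂ)‖
      ≤ δ ^ 3 * (K ^ 3 * Real.exp K) := by
    rw [← hpoly, ← integral_sub hexpi hpi]
    refine (norm_integral_le_of_norm_le_const (C := δ ^ 3 * (K ^ 3 * Real.exp K))
      (ae_of_all _ fun x => ?_)).trans (by simp)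
    have h := Complex.norm_exp_sub_sum_le_norm_mul_exp (Complex.I * ↑(δ * f x)) 3
    have hn : ‖Complex.I * ((δ * f x : ℝ) : ℂ)‖ = δ * |f x| := by
      rw [norm_mul, Complex.norm_I, one_mul, Complex.norm_real, Real.norm_eq_abs, abs_mul,
        abs_of_nonneg hδ]
    rw [hn] at h
    simp only [Finset.sum_range_succ, Finset.range_zero, Finset.sum_empty, zero_add, pow_zero,
      Nat.factorial, pow_one, Nat.cast_one, div_one] at h
    norm_num at h
    norm_num
    refine h.trans ?_
    have h3 : δ * |f x| ≤ K := by nlinarith [hK x, abs_nonneg (f x)]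
    rw [mul_pow, mul_assoc]
    gcongr
    exact hK x
  have hB : ‖Complex.exp (-((δ ^ 2 * V) / 2 : ℝ)) - ((1 - δ ^ 2 * V / 2 : ℝ) : ℂ)‖
      ≤ δ ^ 3 * (K ^ 4 * Real.exp (K ^ 2)) := by
    have h := Complex.norm_exp_sub_sum_le_norm_mul_exp (-((δ ^ 2 * V) / 2 : ℝ)) 2
    have hn : ‖-(((δ ^ 2 * V) / 2 : ℝ) : ℂ)‖ = δ ^ 2 * V / 2 := by
      rw [norm_neg, Complex.norm_real, Real.norm_eq_abs, abs_of_nonneg (by positivity)]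
    rw [hn] at h
    simp only [Finset.sum_range_succ, Finset.range_zero, Finset.sum_empty, zero_add, pow_zero,
      Nat.factorial_zero, Nat.factorial_one, pow_one, Nat.cast_one, div_one] at h
    have h1 : (1 : ℂ) + -(((δ ^ 2 * V) / 2 : ℝ) : ℂ) = ((1 - δ ^ 2 * V / 2 : ℝ) : ℂ) := by
      push_cast
      ring
    rw [h1] at h
    refine h.trans ?_
    have h2 : δ ^ 2 * V / 2 ≤ δ ^ 2 * K ^ 2 := by nlinarith [sq_nonneg δ]
    have h4 : δ ^ 2 ≤ 1 := pow_le_one₀ hδ hδ1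
    have h3 : δ ^ 2 * V / 2 ≤ K ^ 2 := by nlinarith [sq_nonneg K]
    calc (δ ^ 2 * V / 2) ^ 2 * Real.exp (δ ^ 2 * V / 2)
        ≤ (δ ^ 2 * K ^ 2) ^ 2 * Real.exp (K ^ 2) := by gcongr
      -- The error has order `δ ^ 4`; one factor is given up to match the order of the other error.
      _ = δ * (δ ^ 3 * (K ^ 4 * Real.exp (K ^ 2))) := by ring
      _ ≤ 1 * (δ ^ 3 * (K ^ 4 * Real.exp (K ^ 2))) := by gcongr
      _ = _ := one_mul _
  rw [norm_sub_rev] at hB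
  have := norm_sub_le_norm_sub_add_norm_sub
    (∫ x, Complex.exp (Complex.I * ↑(δ * f x)) ∂ν) ((1 - δ ^ 2 * V / 2 : ℝ) : ℂ)
    (Complex.exp (-((δ ^ 2 * V) / 2 : ℝ)))
  linarith

/-- Quantitative central limit theorem for the characteristic function of a normalised sum of
bounded i.i.d. variables. -/
lemma norm_integral_cexp_pow_sub_le {α : Type*} [MeasurableSpace α] {ν : Measure α}
    [IsProbabilityMeasure ν] {f : α → ℝ} (hf : Measurable f) {K : ℝ} (hK : ∀ x, |f x| ≤ K)
    {N : ℕ} (hN : 0 < N) :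
    ‖(∫ x, Complex.exp (Complex.I * ↑((√(N : ℝ))⁻¹ * f x)) ∂ν) ^ N
      - Complex.exp (Complex.I * ↑(√(N : ℝ) * ∫ x, f x ∂ν))
        * Complex.exp (-((∫ x, (f x - ∫ y, f y ∂ν) ^ 2 ∂ν) / 2 : ℝ))‖ ≤
      (√(N : ℝ))⁻¹ * ((2 * K) ^ 3 * Real.exp (2 * K) + (2 * K) ^ 4 * Real.exp ((2 * K) ^ 2)) := by
  set m := ∫ y, f y ∂ν with hm
  set V := ∫ x, (f x - m) ^ 2 ∂ν with hV
  have hfi : Integrable f ν := Integrable.of_bound hf.aestronglyMeasurable K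
    (ae_of_all _ fun x => by simpa using hK x)
  have hmK : |m| ≤ K := by
    have := norm_integral_le_of_norm_le_const (μ := ν) (f := f) (C := K)
      (ae_of_all _ fun x => by simpa using hK x)
    simpa using this
  have hNr : (0 : ℝ) < N := by exact_mod_cast hN
  have hs : 0 < √(N : ℝ) := Real.sqrt_pos.2 hNr
  have hss : √(N : ℝ) * √(N : ℝ) = N := Real.mul_self_sqrt hNr.le
  have h1N : 1 ≤ √(N : ℝ) := by
    rw [Real.one_le_sqrt]
    exact_mod_cast hN
  set δ := (√(N : ℝ))⁻¹ with hδ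
  have hδN : (N : ℝ) * δ ^ 2 = 1 := by
    rw [hδ, inv_pow, sq, hss, mul_inv_cancel₀ hNr.ne']
  have hδm : (N : ℝ) * δ = √(N : ℝ) := by
    rw [hδ]
    nth_rewrite 1 [← hss]
    rw [mul_assoc, mul_inv_cancel₀ hs.ne', mul_one]
  have hδ0 : 0 ≤ δ := by positivity
  -- Centring doubles the bound, hence `2 * K`. Each of the `N` factors costs `δ ^ 3`, and `N * δ ^
  -- 2 = 1` leaves a total of order `δ`. The mean only contributes a phase, factored out below.
  have hmain := norm_integral_cexp_sub_le (ν := ν) (f := fun x => f x - m) (K := 2 * K) (δ := δ)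
    (hf.sub_const m) (fun x => (abs_sub _ _).trans (by linarith [hK x]))
    (by rw [integral_sub hfi (integrable_const _)]; simp [hm]) hδ0 (inv_le_one_of_one_le₀ h1N)
  rw [← hV] at hmain
  set ψ := ∫ x, Complex.exp (Complex.I * ↑(δ * (f x - m))) ∂ν with hψ
  have hfac : ∫ x, Complex.exp (Complex.I * ↑(δ * f x)) ∂ν
      = Complex.exp (Complex.I * ↑(δ * m)) * ψ := by
    rw [hψ, ← integral_const_mul]
    congr 1
    funext x
    rw [← Complex.exp_add]
    congr 1
    push_cast
    ring
  have hψ1 : ‖ψ‖ ≤ 1 := by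
    refine (norm_integral_le_of_norm_le_const (C := 1) (ae_of_all _ fun x => ?_)).trans (by simp)
    rw [mul_comm, Complex.norm_exp_ofReal_mul_I]
  have hV0 : 0 ≤ V := integral_nonneg fun x => sq_nonneg _
  have he1 : ‖Complex.exp (-((δ ^ 2 * V) / 2 : ℝ))‖ ≤ 1 := by
    rw [← Complex.ofReal_neg, Complex.norm_exp_ofReal, Real.exp_le_one_iff]
    have : 0 ≤ δ ^ 2 * V / 2 := by positivity
    linarith
  have hpow := (norm_pow_sub_pow_le_of_norm_le_one hψ1 he1 N).trans
    (mul_le_mul_of_nonneg_left hmain hNr.le)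
  have heN : Complex.exp (-((δ ^ 2 * V) / 2 : ℝ)) ^ N = Complex.exp (-(V / 2 : ℝ)) := by
    rw [← Complex.exp_nat_mul]
    congr 1
    have : (N : ℝ) * (-((δ ^ 2 * V) / 2)) = -(V / 2) := by linear_combination (-V / 2) * hδN
    exact_mod_cast this
  have heM : Complex.exp (Complex.I * ↑(δ * m)) ^ N
      = Complex.exp (Complex.I * ↑(√(N : ℝ) * m)) := by
    rw [← Complex.exp_nat_mul, ← hδm]
    congr 1
    push_cast
    ring
  rw [hfac, mul_pow, heM, ← mul_sub, norm_mul, mul_comm Complex.I, Complex.norm_exp_ofReal_mul_I,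
    one_mul, ← heN]
  refine hpow.trans (le_of_eq ?_)
  linear_combination (δ * ((2 * K) ^ 3 * Real.exp (2 * K)
    + (2 * K) ^ 4 * Real.exp ((2 * K) ^ 2))) * hδN

/-! ### Bounded measurable functions and empirical means -/

lemma BddMeas.integrable {α F : Type*} [MeasurableSpace α] [NormedAddCommGroup F]
    [MeasurableSpace F] [BorelSpace F] [SecondCountableTopology F] {φ : α → F} (h : BddMeas φ)
    (μ : Measure α) [IsFiniteMeasure μ] : Integrable φ μ := by
  obtain ⟨hm, C, hC⟩ := h
  exact Integrable.of_bound hm.aestronglyMeasurable C (ae_of_all _ hC)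

lemma BddMeas.const {α F : Type*} [MeasurableSpace α] [NormedAddCommGroup F]
    [MeasurableSpace F] (c : F) : BddMeas (fun _ : α => c) :=
  ⟨measurable_const, ‖c‖, fun _ => le_rfl⟩

lemma BddMeas.add {α F : Type*} [MeasurableSpace α] [NormedAddCommGroup F]
    [MeasurableSpace F] [BorelSpace F] [SecondCountableTopology F] {φ ψ : α → F}
    (h : BddMeas φ) (h' : BddMeas ψ) : BddMeas (fun x => φ x + ψ x) := by
  obtain ⟨hm, C, hC⟩ := h
  obtain ⟨hm', C', hC'⟩ := h'
  exact ⟨hm.add hm', C + C', fun x => (norm_add_le _ _).trans (add_le_add (hC x) (hC' x))⟩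

lemma BddMeas.sub_const {α F : Type*} [MeasurableSpace α] [NormedAddCommGroup F]
    [MeasurableSpace F] [BorelSpace F] [SecondCountableTopology F] {φ : α → F}
    (h : BddMeas φ) (c : F) : BddMeas (fun x => φ x - c) := by
  simpa [sub_eq_add_neg] using h.add (BddMeas.const (-c))

lemma BddMeas.clm_comp {α F F' : Type*} [MeasurableSpace α] [NormedAddCommGroup F]
    [NormedSpace ℝ F] [MeasurableSpace F] [BorelSpace F] [NormedAddCommGroup F']
    [NormedSpace ℝ F'] [MeasurableSpace F'] [BorelSpace F'] {φ : α → F}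
    (h : BddMeas φ) (ℓ : F →L[ℝ] F') : BddMeas (fun x => ℓ (φ x)) := by
  obtain ⟨hm, C, hC⟩ := h
  exact ⟨ℓ.continuous.measurable.comp hm, ‖ℓ‖ * C, fun x => (ℓ.le_opNorm _).trans
    (mul_le_mul_of_nonneg_left (hC x) (norm_nonneg _))⟩

lemma BddMeas.const_mul {α : Type*} [MeasurableSpace α] {φ : α → ℝ} (h : BddMeas φ) (c : ℝ) :
    BddMeas (fun x => c * φ x) := by
  obtain ⟨hm, C, hC⟩ := h
  refine ⟨hm.const_mul c, |c| * C, fun x => ?_⟩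
  rw [norm_mul]
  exact mul_le_mul_of_nonneg_left (hC x) (abs_nonneg _)

lemma BddMeas.sq {α : Type*} [MeasurableSpace α] {φ : α → ℝ} (h : BddMeas φ) :
    BddMeas (fun x => φ x ^ 2) := by
  obtain ⟨hm, C, hC⟩ := h
  refine ⟨hm.pow_const 2, C ^ 2, fun x => ?_⟩
  rw [norm_pow]
  exact pow_le_pow_left₀ (norm_nonneg _) (hC x) 2

/-- The mean of `φ` over `N` points. -/
def empMean {α F : Type*} [AddCommGroup F] [Module ℝ F] {N : ℕ} (φ : α → F) (x : Fin N → α) : F :=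
  (N : ℝ)⁻¹ • ∑ i, φ (x i)

section empMean

variable {α F : Type*} [MeasurableSpace α] {N : ℕ}

lemma integral_empirical [NormedAddCommGroup F] [NormedSpace ℝ F] [CompleteSpace F] {φ : α → F}
    (hφ : StronglyMeasurable φ) (x : Fin N → α) :
    ∫ y, φ y ∂(empirical x) = empMean φ x := by
  rw [empirical, integral_smul_measure, integral_finsetSum_measure
    (fun i _ => integrable_dirac' hφ enorm_lt_top)]
  simp [integral_dirac' _ _ hφ, empMean]

lemma isProbabilityMeasure_empirical (hN : 0 < N) (x : Fin N → α) :
    IsProbabilityMeasure (empirical x) := by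
  constructor
  simp only [empirical, Measure.smul_apply, Measure.coe_finsetSum, Finset.sum_apply,
    measure_univ, Finset.sum_const, Finset.card_univ, Fintype.card_fin, nsmul_eq_mul, mul_one,
    smul_eq_mul]
  exact ENNReal.inv_mul_cancel (by simpa using hN.ne') (by simp)

lemma measurable_empMean [AddCommGroup F] [Module ℝ F] [MeasurableSpace F] [MeasurableAdd₂ F]
    [MeasurableConstSMul ℝ F] {φ : α → F} (hφ : Measurable φ) :
    Measurable (empMean φ : (Fin N → α) → F) := by
  unfold empMean
  refine Measurable.const_smul ?_ _
  exact Finset.measurable_sum _ fun i _ => hφ.comp (measurable_pi_apply i)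

omit [MeasurableSpace α] in
lemma empMean_const [AddCommGroup F] [Module ℝ F] (hN : 0 < N) (c : F) (x : Fin N → α) :
    empMean (fun _ => c) x = c := by
  have : (N : ℝ) ≠ 0 := by positivity
  simp only [empMean, Finset.sum_const, Finset.card_univ, Fintype.card_fin]
  rw [← Nat.cast_smul_eq_nsmul ℝ, smul_smul, inv_mul_cancel₀ this, one_smul]

omit [MeasurableSpace α] in
lemma empMean_add [AddCommGroup F] [Module ℝ F] (φ ψ : α → F) (x : Fin N → α) :
    empMean (fun y => φ y + ψ y) x = empMean φ x + empMean ψ x := by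
  simp [empMean, Finset.sum_add_distrib]

omit [MeasurableSpace α] in
lemma empMean_sub [AddCommGroup F] [Module ℝ F] (φ ψ : α → F) (x : Fin N → α) :
    empMean (fun y => φ y - ψ y) x = empMean φ x - empMean ψ x := by
  simp [empMean, Finset.sum_sub_distrib, smul_sub]

omit [MeasurableSpace α] in
lemma empMean_sub_const [AddCommGroup F] [Module ℝ F] (hN : 0 < N) (φ : α → F) (c : F)
    (x : Fin N → α) : empMean (fun y => φ y - c) x = empMean φ x - c := by
  rw [empMean_sub, empMean_const hN]

omit [MeasurableSpace α] in
lemma map_empMean {F' : Type*} [AddCommGroup F] [Module ℝ F] [AddCommGroup F'] [Module ℝ F']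
    (ℓ : F →ₗ[ℝ] F') (φ : α → F) (x : Fin N → α) :
    ℓ (empMean φ x) = empMean (fun y => ℓ (φ y)) x := by
  simp [empMean]

omit [MeasurableSpace α] in
lemma norm_empMean_le [NormedAddCommGroup F] [NormedSpace ℝ F] {φ : α → F} {C : ℝ}
    (hN : 0 < N) (hC : ∀ y, ‖φ y‖ ≤ C) (x : Fin N → α) : ‖empMean φ x‖ ≤ C := by
  have hN' : (0 : ℝ) < N := by exact_mod_cast hN
  rw [empMean, norm_smul, norm_inv, Real.norm_natCast, inv_mul_le_iff₀ hN']
  refine (norm_sum_le _ _).trans ?_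
  simpa using Finset.sum_le_sum fun i (_ : i ∈ Finset.univ) => hC (x i)

omit [MeasurableSpace α] in
lemma empMean_pos {φ : α → ℝ} (hN : 0 < N) (h : ∀ y, 0 < φ y) (x : Fin N → α) :
    0 < empMean φ x := by
  have hN' : (0 : ℝ) < N := by exact_mod_cast hN
  have : Nonempty (Fin N) := ⟨⟨0, hN⟩⟩
  exact mul_pos (inv_pos.2 hN') (Finset.sum_pos (fun i _ => h _) Finset.univ_nonempty)

omit [MeasurableSpace α] in
lemma empMean_mem [AddCommGroup F] [Module ℝ F] {s : Set F} (hs : Convex ℝ s) (hN : 0 < N)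
    {φ : α → F} (h : ∀ y, φ y ∈ s) (x : Fin N → α) : empMean φ x ∈ s := by
  have hN' : (N : ℝ) ≠ 0 := by positivity
  rw [empMean, Finset.smul_sum]
  refine hs.sum_mem (fun i _ => by positivity) ?_ (fun i _ => h _)
  simp [hN']

/-- Mean square error of the empirical mean of an i.i.d. sample. -/
lemma integral_sq_empMean_sub {ν : Measure α} [IsProbabilityMeasure ν] {φ : α → ℝ}
    (hφ : BddMeas φ) (hN : 0 < N) (c : ℝ) :
    ∫ x : Fin N → α, (empMean φ x - c) ^ 2 ∂(Measure.pi fun _ => ν)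
      = (∫ y, φ y ∂ν - c) ^ 2 + (∫ y, (φ y - ∫ z, φ z ∂ν) ^ 2 ∂ν) / N := by
  have hN' : (N : ℝ) ≠ 0 := by positivity
  obtain ⟨C, hC⟩ := hφ.2
  have hi := hφ.integrable ν
  have hL : MemLp φ 2 ν := MemLp.of_bound hφ.1.aestronglyMeasurable C (ae_of_all _ hC)
  have hb : BddMeas (empMean φ : (Fin N → α) → ℝ) :=
    ⟨measurable_empMean hφ.1, C, norm_empMean_le hN hC⟩
  have hmean : ∫ x : Fin N → α, empMean φ x ∂(Measure.pi fun _ => ν) = ∫ y, φ y ∂ν := by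
    simp only [empMean, smul_eq_mul]
    rw [integral_const_mul, integral_finsetSum]
    · have : ∀ i : Fin N, ∫ x : Fin N → α, φ (x i) ∂(Measure.pi fun _ => ν) = ∫ y, φ y ∂ν :=
        fun i => integral_comp_eval (μ := fun _ : Fin N => ν) hi.aestronglyMeasurable
      simp [this, hN']
    · intro i _
      exact integrable_comp_eval (μ := fun _ : Fin N => ν) hi
  have hvar : Var[(empMean φ : (Fin N → α) → ℝ); Measure.pi fun _ => ν]
      = (∫ y, (φ y - ∫ z, φ z ∂ν) ^ 2 ∂ν) / N := by
    have h1 : (empMean φ : (Fin N → α) → ℝ)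
        = fun x => (N : ℝ)⁻¹ * (∑ i, fun x : Fin N → α => φ (x i)) x := by
      funext x
      simp [empMean]
    rw [h1, variance_const_mul, variance_sum_pi fun _ => hL]
    simp only [Finset.sum_const, Finset.card_univ, Fintype.card_fin, nsmul_eq_mul]
    rw [variance_eq_integral hφ.1.aemeasurable]
    field_simp
  rw [variance_eq_integral hb.1.aemeasurable, hmean] at hvar
  set m := ∫ y, φ y ∂ν with hm
  rw [← hvar]
  have hd : BddMeas (fun x : Fin N → α => empMean φ x - m) := hb.sub_const m
  -- Bias-variance decomposition about the true mean `m`; the cross term integrates to zero.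
  have h2 : ∀ x : Fin N → α, (empMean φ x - c) ^ 2
      = (empMean φ x - m) ^ 2 + (2 * (m - c) * (empMean φ x - m) + (m - c) ^ 2) := fun x => by ring
  simp_rw [h2]
  have hi1 : Integrable (fun x : Fin N → α => 2 * (m - c) * (empMean φ x - m) + (m - c) ^ 2)
      (Measure.pi fun _ => ν) := ((hd.integrable _).const_mul _).add (integrable_const _)
  rw [integral_add (hd.sq.integrable _) hi1, integral_add ((hd.integrable _).const_mul _)
    (integrable_const _), integral_const_mul,
    integral_sub (hb.integrable _) (integrable_const _), hmean]
  simp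
  ring

end empMean

/-! ### The operators `Q` and `Phi`, and the limiting flow -/

lemma integral_bind_kernel {α β F : Type*} [MeasurableSpace α] [MeasurableSpace β]
    [NormedAddCommGroup F] [NormedSpace ℝ F] {μ : Measure α} {κ : Kernel α β}
    {f : β → F} (hf : Integrable f (μ.bind κ)) :
    ∫ y, f y ∂(μ.bind κ) = ∫ x, ∫ y, f y ∂(κ x) ∂μ := by
  have h : (κ ∘ₖ Kernel.const Unit μ) () = μ.bind κ := by
    rw [Kernel.comp_apply, Kernel.const_apply]
  have h2 := Kernel.integral_comp (κ := Kernel.const Unit μ) (η := κ) (a := ()) (f := f)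
    (by rwa [h])
  rwa [h, Kernel.const_apply] at h2

namespace AdaptiveSMC

variable {d : ℕ} {E : ℕ → Type*} [∀ n, MeasurableSpace (E n)]

section Q

variable {F : Type*} [NormedAddCommGroup F] [NormedSpace ℝ F] (S : AdaptiveSMC d E) {n : ℕ}
  (ξ : EuclideanSpace ℝ (Fin d))

/-- Regularity in `ξ` assumed for `Q` passes to `G` through the test function `1`. The
differentiability assumption itself does not mention `G`. -/
lemma Q_one : S.Q n ξ (fun _ => (1 : ℝ)) = S.G n ξ := by
  funext x
  simp [Q]

lemma bddMeas_Q [MeasurableSpace F] [BorelSpace F] [SecondCountableTopology F]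
    (hA1 : S.HypContinuity) {φ : E (n + 1) → F} (hφ : BddMeas φ) : BddMeas (S.Q n ξ φ) := by
  obtain ⟨C, hC⟩ := hA1.G_bdd n
  obtain ⟨C', hC'⟩ := hφ.2
  refine ⟨(S.measurable_G n ξ).smul
    (hφ.1.stronglyMeasurable.integral_kernel (κ := S.M n ξ)).measurable, C * C', fun x => ?_⟩
  rw [Q, norm_smul]
  have h1 : ‖∫ y, φ y ∂(S.M n ξ x)‖ ≤ C' :=
    (norm_integral_le_of_norm_le_const (ae_of_all _ hC')).trans (by simp)
  exact mul_le_mul (hC x ξ) h1 (norm_nonneg _) ((abs_nonneg _).trans (hC x ξ))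

lemma bddMeas_G (hA1 : S.HypContinuity) : BddMeas (S.G n ξ) := by
  rw [← S.Q_one]
  exact S.bddMeas_Q ξ hA1 (BddMeas.const 1)

lemma Q_clm_comp {F' : Type*} [NormedAddCommGroup F'] [NormedSpace ℝ F'] [CompleteSpace F]
    [CompleteSpace F'] [MeasurableSpace F] [BorelSpace F] [SecondCountableTopology F]
    {φ : E (n + 1) → F} (hφ : BddMeas φ) (ℓ : F →L[ℝ] F') (x : E n) :
    S.Q n ξ (fun y => ℓ (φ y)) x = ℓ (S.Q n ξ φ x) := by
  simp only [Q, map_smul]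
  rw [ℓ.integral_comp_comm (hφ.integrable _)]

end Q

section Phi

variable (S : AdaptiveSMC d E) (hA1 : S.HypContinuity) {n : ℕ} (ξ : EuclideanSpace ℝ (Fin d))
  (μ : Measure (E n)) [IsProbabilityMeasure μ]

include hA1

lemma lintegral_G : ∫⁻ x, ENNReal.ofReal (S.G n ξ x) ∂μ = ENNReal.ofReal (∫ x, S.G n ξ x ∂μ) :=
  (ofReal_integral_eq_lintegral_ofReal ((S.bddMeas_G ξ hA1).integrable μ)
    (ae_of_all _ fun x => (S.G_pos n ξ x).le)).symm

lemma integral_G_pos : 0 < ∫ x, S.G n ξ x ∂μ := by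
  rw [integral_pos_iff_support_of_nonneg (fun x => (S.G_pos n ξ x).le)
    ((S.bddMeas_G ξ hA1).integrable μ)]
  have : Function.support (S.G n ξ) = Set.univ :=
    Set.eq_univ_of_forall fun x => (S.G_pos n ξ x).ne'
  simp [this]

lemma Phi_eq : S.Phi n ξ μ = (ENNReal.ofReal (∫ x, S.G n ξ x ∂μ))⁻¹ •
    (μ.withDensity (fun x => ENNReal.ofReal (S.G n ξ x))).bind (S.M n ξ) := by
  rw [Phi, S.lintegral_G hA1]

lemma bind_univ : (μ.withDensity (fun x => ENNReal.ofReal (S.G n ξ x))).bind (S.M n ξ) Set.univ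
    = ENNReal.ofReal (∫ x, S.G n ξ x ∂μ) := by
  rw [Measure.bind_apply MeasurableSet.univ (Kernel.aemeasurable _)]
  simp [S.lintegral_G hA1]

lemma isProbabilityMeasure_Phi : IsProbabilityMeasure (S.Phi n ξ μ) := by
  constructor
  rw [S.Phi_eq hA1, Measure.smul_apply, S.bind_univ hA1, smul_eq_mul]
  exact ENNReal.inv_mul_cancel (by simpa using S.integral_G_pos hA1 ξ μ) (by simp)

lemma integral_Phi {F : Type*} [NormedAddCommGroup F] [NormedSpace ℝ F]
    [MeasurableSpace F] [BorelSpace F] [SecondCountableTopology F]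
    {φ : E (n + 1) → F} (hφ : BddMeas φ) :
    ∫ y, φ y ∂(S.Phi n ξ μ) = (∫ x, S.G n ξ x ∂μ)⁻¹ • ∫ x, S.Q n ξ φ x ∂μ := by
  have : IsFiniteMeasure ((μ.withDensity (fun x => ENNReal.ofReal (S.G n ξ x))).bind (S.M n ξ)) :=
    ⟨by rw [S.bind_univ hA1]; simp⟩
  rw [S.Phi_eq hA1, integral_smul_measure, integral_bind_kernel (hφ.integrable _),
    integral_withDensity_eq_integral_toReal_smul (S.measurable_G n ξ).ennreal_ofReal
      (ae_of_all _ fun x => by simp)]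
  rw [ENNReal.toReal_inv, ENNReal.toReal_ofReal (S.integral_G_pos hA1 ξ μ).le]
  simp only [Q, ENNReal.toReal_ofReal (S.G_pos n ξ _).le]

end Phi

section eta

variable (S : AdaptiveSMC d E) (hA1 : S.HypContinuity) (n : ℕ)

lemma eta_zero : S.eta 0 = S.η₀ := by
  simp [eta, etaOf, gammaOf_zero]

lemma gamma_zero : S.gamma 0 = S.η₀ := S.gammaOf_zero _

lemma gamma_succ : S.gamma (n + 1) = ((S.gamma n).withDensity
      (fun x => ENNReal.ofReal (S.limG n x))).bind (S.M n (S.limitParam n)) :=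
  S.gammaOf_succ _ n

lemma eta_eq : S.eta n = (S.gamma n Set.univ)⁻¹ • S.gamma n := rfl

include hA1

lemma gamma_univ_pos_lt_top : 0 < S.gamma n Set.univ ∧ S.gamma n Set.univ < ∞ := by
  induction n with
  | zero => simp [gamma_zero]
  | succ n ih =>
    have h : S.gamma (n + 1) Set.univ = ∫⁻ x, ENNReal.ofReal (S.limG n x) ∂(S.gamma n) := by
      rw [gamma_succ, Measure.bind_apply MeasurableSet.univ (Kernel.aemeasurable _)]
      simp
    have hm : Measurable (fun x => ENNReal.ofReal (S.limG n x)) :=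
      (S.measurable_G n _).ennreal_ofReal
    rw [h]
    constructor
    · rw [lintegral_pos_iff_support hm]
      have : Function.support (fun x => ENNReal.ofReal (S.limG n x)) = Set.univ :=
        Set.eq_univ_of_forall fun x => (ENNReal.ofReal_pos.2 (S.G_pos n _ x)).ne'
      rw [this]
      exact ih.1
    · obtain ⟨C, hC⟩ := hA1.G_bdd n
      refine (lintegral_mono (g := fun _ => ENNReal.ofReal C) fun x =>
        ENNReal.ofReal_le_ofReal ((le_abs_self _).trans (hC x _))).trans_lt ?_
      rw [lintegral_const]
      exact ENNReal.mul_lt_top (by simp) ih.2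

lemma isProbabilityMeasure_eta : IsProbabilityMeasure (S.eta n) := by
  obtain ⟨h1, h2⟩ := S.gamma_univ_pos_lt_top hA1 n
  constructor
  rw [eta_eq, Measure.smul_apply, smul_eq_mul]
  exact ENNReal.inv_mul_cancel h1.ne' h2.ne

/-- The mass of `γ_n` cancels between the numerator and the denominator of `Phi`, so the flow closes
on normalised measures and takes the same form as the particle update. -/
lemma eta_succ : S.eta (n + 1) = S.Phi n (S.limitParam n) (S.eta n) := by
  obtain ⟨h1, h2⟩ := S.gamma_univ_pos_lt_top hA1 n
  have h : S.gamma (n + 1) Set.univ = ∫⁻ x, ENNReal.ofReal (S.limG n x) ∂(S.gamma n) := by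
    rw [gamma_succ, Measure.bind_apply MeasurableSet.univ (Kernel.aemeasurable _)]
    simp
  rw [eta_eq, Phi, h, gamma_succ, eta_eq, lintegral_smul_measure, withDensity_smul_measure,
    Measure.bind_smul, smul_smul]
  congr 1
  rw [smul_eq_mul, ENNReal.mul_inv (Or.inl (by simpa using h2.ne))
    (Or.inl (by simpa using h1.ne')), inv_inv, mul_comm,
    ← mul_assoc, ENNReal.inv_mul_cancel h1.ne' h2.ne, one_mul]
  rfl

lemma gamma_real_succ : (S.gamma (n + 1)).real Set.univ
    = (S.gamma n).real Set.univ * ∫ x, S.limG n x ∂(S.eta n) := by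
  obtain ⟨h1, h2⟩ := S.gamma_univ_pos_lt_top hA1 n
  have := S.isProbabilityMeasure_eta hA1 n
  have h : S.gamma (n + 1) Set.univ = ∫⁻ x, ENNReal.ofReal (S.limG n x) ∂(S.gamma n) := by
    rw [gamma_succ, Measure.bind_apply MeasurableSet.univ (Kernel.aemeasurable _)]
    simp
  have h3 : S.gamma n = S.gamma n Set.univ • S.eta n := by
    rw [eta_eq, smul_smul, ENNReal.mul_inv_cancel h1.ne' h2.ne, one_smul]
  have h4 : S.gamma (n + 1) Set.univ
      = S.gamma n Set.univ * ENNReal.ofReal (∫ x, S.limG n x ∂(S.eta n)) := by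
    rw [h, limG, ← S.lintegral_G hA1, h3, lintegral_smul_measure, ← h3, smul_eq_mul]
  have h5 : 0 ≤ ∫ x, S.limG n x ∂(S.eta n) := (S.integral_G_pos hA1 _ _).le
  rw [Measure.real, h4, ENNReal.toReal_mul, ENNReal.toReal_ofReal h5]
  rfl

lemma integral_eta_succ {F : Type*} [NormedAddCommGroup F] [NormedSpace ℝ F]
    [MeasurableSpace F] [BorelSpace F] [SecondCountableTopology F]
    {φ : E (n + 1) → F} (hφ : BddMeas φ) :
    ∫ y, φ y ∂(S.eta (n + 1))
      = (∫ x, S.limG n x ∂(S.eta n))⁻¹ • ∫ x, S.Q n (S.limitParam n) φ x ∂(S.eta n) := by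
  have := S.isProbabilityMeasure_eta hA1 n
  rw [S.eta_succ hA1, S.integral_Phi hA1 _ _ hφ]
  rfl

lemma bddMeas_stat : BddMeas (S.stat n) := ⟨S.measurable_stat n, hA1.stat_bdd n⟩

/-- Derivatives are controlled on `Dom` only, and `Dom` may fail to be closed. Convexity alone still
places the limiting mean in it. -/
lemma limitParam_mem {s : Set (EuclideanSpace ℝ (Fin d))} (hs : Convex ℝ s)
    (h : Set.range (S.stat n) ⊆ s) : S.limitParam n ∈ s := by
  have := S.isProbabilityMeasure_eta hA1 n
  rw [S.limitParam_eq]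
  exact hs.integral_mem_of_finiteDimensional (ae_of_all _ fun x => h ⟨x, rfl⟩)
    ((S.bddMeas_stat hA1 n).integrable _)

end eta

end AdaptiveSMC

/-! ### One step of the algorithm: measurability and mixtures of product laws -/

/-- A product of identical laws depends measurably on a parameter if the law does. -/
lemma measurable_measure_pi {α β ι : Type*} [MeasurableSpace α] [MeasurableSpace β] [Fintype ι]
    {ν : α → Measure β} [∀ a, IsProbabilityMeasure (ν a)] (hν : Measurable ν) :
    Measurable (fun a => Measure.pi fun _ : ι => ν a) := by
  refine Measurable.measure_of_isPiSystem_of_isProbabilityMeasure generateFrom_pi.symm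
    isPiSystem_pi ?_
  rintro _ ⟨s, hs, rfl⟩
  simp_rw [Measure.pi_pi]
  exact Finset.measurable_prod _ fun i _ =>
    (Measure.measurable_coe (hs i (Set.mem_univ i))).comp hν

lemma integral_cexp_empMean {α : Type*} [MeasurableSpace α] {ν : Measure α}
    [IsProbabilityMeasure ν] {N : ℕ} (hN : 0 < N) (φ : α → ℝ) :
    ∫ x : Fin N → α, Complex.exp (Complex.I * ↑(√(N : ℝ) * empMean φ x)) ∂(Measure.pi fun _ => ν)
      = (∫ y, Complex.exp (Complex.I * ↑((√(N : ℝ))⁻¹ * φ y)) ∂ν) ^ N := by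
  have hNr : (0 : ℝ) < N := by exact_mod_cast hN
  have h : √(N : ℝ) * (N : ℝ)⁻¹ = (√(N : ℝ))⁻¹ := by
    nth_rewrite 2 [← Real.mul_self_sqrt hNr.le]
    rw [mul_inv, ← mul_assoc, mul_inv_cancel₀ (Real.sqrt_pos.2 hNr).ne', one_mul]
  have h2 := integral_fintype_prod_eq_pow (𝕜 := ℂ) (ι := Fin N) (μ := ν)
    (fun y => Complex.exp (Complex.I * ↑((√(N : ℝ))⁻¹ * φ y)))
  rw [Fintype.card_fin] at h2
  rw [← h2]
  congr 1
  funext x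
  rw [← Complex.exp_sum, empMean, smul_eq_mul, ← mul_assoc, h, Finset.mul_sum, Complex.ofReal_sum,
    Finset.mul_sum]

namespace AdaptiveSMC

variable {d : ℕ} {E : ℕ → Type*} [∀ n, MeasurableSpace (E n)]

section PhiN

variable (S : AdaptiveSMC d E) (hA1 : S.HypContinuity) {n N : ℕ}

lemma PhiN_eq (x : Fin N → E n) :
    S.PhiN n x = S.Phi n (empMean (S.stat n) x) (empirical x) := by
  rw [PhiN, integral_empirical (S.measurable_stat n).stronglyMeasurable]

include hA1

lemma isProbabilityMeasure_PhiN (hN : 0 < N) (x : Fin N → E n) :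
    IsProbabilityMeasure (S.PhiN n x) := by
  have := isProbabilityMeasure_empirical hN x
  exact S.isProbabilityMeasure_Phi hA1 _ _

lemma integral_PhiN (hN : 0 < N) {φ : E (n + 1) → ℝ} (hφ : BddMeas φ) (x : Fin N → E n) :
    ∫ y, φ y ∂(S.PhiN n x) = (empMean (S.G n (empMean (S.stat n) x)) x)⁻¹ *
      empMean (S.Q n (empMean (S.stat n) x) φ) x := by
  have := isProbabilityMeasure_empirical hN x
  rw [PhiN_eq, S.integral_Phi hA1 _ _ hφ,
    integral_empirical (S.bddMeas_Q _ hA1 hφ).1.stronglyMeasurable,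
    integral_empirical (S.measurable_G n _).stronglyMeasurable, smul_eq_mul]

variable {Dom : ℕ → Set (EuclideanSpace ℝ (Fin d))} (hDom_convex : ∀ n, Convex ℝ (Dom n))
    (hDom_range : ∀ n, Set.range (S.stat n) ⊆ Dom n) (hA2 : S.HypDifferentiability Dom)

omit hA1 in
include hDom_convex hDom_range in
lemma empMean_stat_mem (hN : 0 < N) (x : Fin N → E n) : empMean (S.stat n) x ∈ Dom n :=
  empMean_mem (hDom_convex n) hN (fun y => hDom_range n ⟨y, rfl⟩) x

include hDom_convex hDom_range hA2

/-- Joint measurability in `(x, ξ)` is not assumed. It follows by a Carathéodory argument: `Q` is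
measurable in the point and, being differentiable, continuous in `ξ` on `Dom`, where convexity keeps
the empirical parameter. -/
lemma measurable_Q_empMean_stat (hN : 0 < N) {φ : E (n + 1) → ℝ} (hφ : BddMeas φ) (i : Fin N) :
    Measurable (fun x : Fin N → E n => S.Q n (empMean (S.stat n) x) φ (x i)) := by
  have h1 : Measurable (Function.uncurry fun (ξ : Dom n) (y : E n) => S.Q n ξ φ y) := by
    refine measurable_uncurry_of_continuous_of_measurable (fun y => ?_)
      fun ξ => (S.bddMeas_Q _ hA1 hφ).1
    rw [continuous_iff_continuousAt]
    intro ξ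
    exact (hA2.diff n φ hφ y ξ ξ.2).continuousAt.comp continuous_subtype_val.continuousAt
  have h2 : Measurable (fun x : Fin N → E n =>
      (⟨empMean (S.stat n) x, S.empMean_stat_mem hDom_convex hDom_range hN x⟩ : Dom n)) :=
    (measurable_empMean (S.measurable_stat n)).subtype_mk
  exact h1.comp (h2.prodMk (measurable_pi_apply i))

lemma measurable_empMean_Q (hN : 0 < N) {φ : E (n + 1) → ℝ} (hφ : BddMeas φ) :
    Measurable (fun x : Fin N → E n => empMean (S.Q n (empMean (S.stat n) x) φ) x) := by
  unfold empMean
  have h := Finset.measurable_sum Finset.univ fun i (_ : i ∈ Finset.univ) =>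
    S.measurable_Q_empMean_stat hA1 hDom_convex hDom_range hA2 hN hφ i
  exact h.const_smul (N : ℝ)⁻¹

lemma measurable_integral_PhiN (hN : 0 < N) {φ : E (n + 1) → ℝ} (hφ : BddMeas φ) :
    Measurable (fun x : Fin N → E n => ∫ y, φ y ∂(S.PhiN n x)) := by
  simp_rw [S.integral_PhiN hA1 hN hφ, ← Q_one]
  exact (S.measurable_empMean_Q hA1 hDom_convex hDom_range hA2 hN (BddMeas.const 1)).inv.mul
    (S.measurable_empMean_Q hA1 hDom_convex hDom_range hA2 hN hφ)

lemma measurable_PhiN (hN : 0 < N) : Measurable (fun x : Fin N → E n => S.PhiN n x) := by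
  refine Measure.measurable_of_measurable_coe _ fun B hB => ?_
  have hb : BddMeas (B.indicator (fun _ => (1 : ℝ))) := by
    refine ⟨measurable_const.indicator hB, 1, fun y => ?_⟩
    by_cases hy : y ∈ B <;> simp [hy]
  have h := (S.measurable_integral_PhiN hA1 hDom_convex hDom_range hA2 hN hb).ennreal_ofReal
  convert h using 2 with x
  have := S.isProbabilityMeasure_PhiN hA1 hN x
  rw [integral_indicator_const _ hB]
  simp

lemma measurable_pi_PhiN (hN : 0 < N) :
    Measurable (fun x : Fin N → E n => Measure.pi fun _ : Fin N => S.PhiN n x) := by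
  have := S.isProbabilityMeasure_PhiN hA1 (n := n) hN
  exact measurable_measure_pi (S.measurable_PhiN hA1 hDom_convex hDom_range hA2 hN)

/-- The law of the particles at time `n + 1` is a mixture of product laws. -/
lemma IsParticleSystem.map_succ {Ω : Type*} [MeasurableSpace Ω] {P : Measure Ω}
    [IsProbabilityMeasure P] {X : ∀ n, Fin N → Ω → E n} (hX : S.IsParticleSystem N P X)
    (hN : 0 < N) (n : ℕ) :
    P.map (fun ω i => X (n + 1) i ω) = (P.map (fun ω i => X n i ω)).bind
      (fun x => Measure.pi fun _ : Fin N => S.PhiN n x) := by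
  have hm : ∀ k, Measurable (fun ω i => X k i ω) := fun k =>
    measurable_pi_lambda _ fun i => hX.measurable k i
  have hκ := S.measurable_pi_PhiN hA1 hDom_convex hDom_range hA2 (n := n) hN
  have hpr := S.isProbabilityMeasure_PhiN hA1 (n := n) hN
  have := Measure.isProbabilityMeasure_map (μ := P) (hm (n + 1)).aemeasurable
  refine ext_of_generate_finite _ generateFrom_pi.symm isPiSystem_pi ?_ ?_
  · rintro _ ⟨B, hB, rfl⟩
    have hB' : ∀ i, MeasurableSet (B i) := fun i => hB i (Set.mem_univ i)
    have hBm : MeasurableSet (Set.pi Set.univ B) := MeasurableSet.univ_pi hB'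
    -- The trivial past event suffices: `PhiN` sees the past only through the particles at time `n`,
    -- and only the law at each single time is needed.
    have h := hX.step n Set.univ MeasurableSet.univ B hB'
    rw [Measure.map_apply (hm _) hBm, Measure.bind_apply hBm hκ.aemeasurable,
      lintegral_map (f := fun x => (Measure.pi fun _ : Fin N => S.PhiN n x) (Set.univ.pi B))
        ((Measure.measurable_coe hBm).comp hκ) (hm n)]
    simp only [Measure.pi_pi]
    rw [Set.univ_inter, Measure.restrict_univ] at h
    rw [← h]
    congr 1
    ext ω
    simp
  · rw [measure_univ, Measure.bind_apply MeasurableSet.univ hκ.aemeasurable]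
    have := Measure.isProbabilityMeasure_map (μ := P) (hm n).aemeasurable
    simp

end PhiN

/-- Laws `μ n N` of the `N` particles at time `n`. -/
structure IsParticleLaw (S : AdaptiveSMC d E) (μ : ∀ n N, Measure (Fin N → E n)) : Prop where
  prob : ∀ n N, IsProbabilityMeasure (μ n N)
  zero : ∀ N, μ 0 N = Measure.pi fun _ => S.η₀
  -- At `N = 0` the empirical measure vanishes and `PhiN` is not a probability measure; the limit
  -- does not see this case.
  succ : ∀ n N, 0 < N →
    μ (n + 1) N = (μ n N).bind (fun x => Measure.pi fun _ : Fin N => S.PhiN n x)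

section Law

variable {S : AdaptiveSMC d E} (hA1 : S.HypContinuity) {n N : ℕ}
  {Dom : ℕ → Set (EuclideanSpace ℝ (Fin d))} (hDom_convex : ∀ n, Convex ℝ (Dom n))
  (hDom_range : ∀ n, Set.range (S.stat n) ⊆ Dom n) (hA2 : S.HypDifferentiability Dom)
  {μ : ∀ n N, Measure (Fin N → E n)} (hμ : S.IsParticleLaw μ)

include hA1 hDom_convex hDom_range hA2 hμ

lemma IsParticleLaw.integral_succ {F : Type*} [NormedAddCommGroup F] [NormedSpace ℝ F]
    [MeasurableSpace F] [BorelSpace F] [SecondCountableTopology F] (hN : 0 < N)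
    {f : (Fin N → E (n + 1)) → F} (hf : BddMeas f) :
    ∫ y, f y ∂(μ (n + 1) N)
      = ∫ x, ∫ y, f y ∂(Measure.pi fun _ : Fin N => S.PhiN n x) ∂(μ n N) := by
  have := hμ.prob (n + 1) N
  have hi := hf.integrable (μ (n + 1) N)
  rw [hμ.succ n N hN] at hi ⊢
  exact integral_bind_kernel
    (κ := ⟨_, S.measurable_pi_PhiN hA1 hDom_convex hDom_range hA2 hN⟩) hi

lemma IsParticleLaw.integral_sq_succ (hN : 0 < N) {φ : E (n + 1) → ℝ} (hφ : BddMeas φ) (c : ℝ) :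
    ∫ y, (empMean φ y - c) ^ 2 ∂(μ (n + 1) N)
      = ∫ x, ((∫ y, φ y ∂(S.PhiN n x) - c) ^ 2
        + (∫ y, (φ y - ∫ z, φ z ∂(S.PhiN n x)) ^ 2 ∂(S.PhiN n x)) / N) ∂(μ n N) := by
  obtain ⟨C, hC⟩ := hφ.2
  have hb : BddMeas (empMean φ : (Fin N → E (n + 1)) → ℝ) :=
    ⟨measurable_empMean hφ.1, C, norm_empMean_le hN hC⟩
  rw [hμ.integral_succ hA1 hDom_convex hDom_range hA2 hN (hb.sub_const c).sq]
  congr 1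
  funext x
  have := S.isProbabilityMeasure_PhiN hA1 hN x
  exact integral_sq_empMean_sub hφ hN c

lemma IsParticleLaw.integral_cexp_succ (hN : 0 < N) {φ : E (n + 1) → ℝ} (hφ : BddMeas φ) :
    ∫ y, Complex.exp (Complex.I * ↑(√(N : ℝ) * empMean φ y)) ∂(μ (n + 1) N)
      = ∫ x, (∫ y, Complex.exp (Complex.I * ↑((√(N : ℝ))⁻¹ * φ y)) ∂(S.PhiN n x)) ^ N
        ∂(μ n N) := by
  have hm : Measurable (empMean φ : (Fin N → E (n + 1)) → ℝ) := measurable_empMean hφ.1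
  rw [hμ.integral_succ hA1 hDom_convex hDom_range hA2 hN]
  · congr 1
    funext x
    have := S.isProbabilityMeasure_PhiN hA1 hN x
    exact integral_cexp_empMean hN φ
  · refine ⟨by fun_prop, 1, fun y => ?_⟩
    simp only [mul_comm Complex.I, Complex.norm_exp_ofReal_mul_I, le_refl]

end Law
end AdaptiveSMC

/-! ### The operator `𝓛` and derivatives in the parameter -/

lemma clm_apply_eq_sum {r : ℕ} {F : Type*} [NormedAddCommGroup F] [NormedSpace ℝ F]
    (ℓ : EuclideanSpace ℝ (Fin r) →L[ℝ] F) (v : EuclideanSpace ℝ (Fin r)) :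
    ℓ v = ∑ j, v j • ℓ (EuclideanSpace.single j 1) := by
  conv_lhs => rw [← (EuclideanSpace.basisFun (Fin r) ℝ).sum_repr v]
  simp

/-- Used to reduce integrability of operator-valued derivatives to finitely many scalar coordinates.
-/
lemma integrable_sum_clm {α ι G H : Type*} [MeasurableSpace α] [Fintype ι] [NormedAddCommGroup G]
    [NormedSpace ℝ G] [NormedAddCommGroup H] [NormedSpace ℝ H] {μ : Measure α} (A : ι → G →L[ℝ] H)
    {f : ι → α → G} (hf : ∀ i, Integrable (f i) μ) {g : α → H}
    (hg : ∀ y, g y = ∑ i, A i (f i y)) : Integrable g μ := by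
  rw [funext hg]
  exact integrable_finsetSum _ fun i _ => (A i).integrable_comp (hf i)

namespace AdaptiveSMC

variable {d : ℕ} {E : ℕ → Type*} [∀ n, MeasurableSpace (E n)]

section L

variable {F : Type*} [NormedAddCommGroup F] [NormedSpace ℝ F] [MeasurableSpace F] [BorelSpace F]
  [SecondCountableTopology F] [CompleteSpace F] (S : AdaptiveSMC d E) (hA1 : S.HypContinuity)
  {n : ℕ} {φ : E (n + 1) → F}

include hA1

omit [CompleteSpace F] in
lemma bddMeas_L (hφ : BddMeas φ) : BddMeas (S.L n φ) :=
  (((S.bddMeas_stat hA1 n).sub_const _).clm_comp _).add (S.bddMeas_Q _ hA1 hφ)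

/-- The derivative term is centred by construction, and `η_n(Q φ) = η_n(G) η_{n+1}(φ) = 0`. Centring
thus propagates backwards, so neither the induction nor the covariance recursion has to recentre. -/
lemma integral_L (hφ : BddMeas φ) (h0 : ∫ y, φ y ∂(S.eta (n + 1)) = 0) :
    ∫ x, S.L n φ x ∂(S.eta n) = 0 := by
  have := S.isProbabilityMeasure_eta hA1 n
  have hs := S.bddMeas_stat hA1 n
  have ha := S.integral_G_pos hA1 (S.limitParam n) (S.eta n)
  have hQ : ∫ x, S.Q n (S.limitParam n) φ x ∂(S.eta n) = 0 := by
    rw [S.integral_eta_succ hA1 n hφ] at h0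
    exact (smul_eq_zero.1 h0).resolve_left (inv_ne_zero ha.ne')
  simp only [L]
  rw [integral_add (((hs.sub_const _).clm_comp _).integrable _)
    ((S.bddMeas_Q _ hA1 hφ).integrable _), hQ, ContinuousLinearMap.integral_comp_comm _
    ((hs.sub_const _).integrable _), integral_sub (hs.integrable _) (integrable_const _)]
  simp

end L

section Deriv

variable (S : AdaptiveSMC d E) (hA1 : S.HypContinuity) {n : ℕ}
  {Dom : ℕ → Set (EuclideanSpace ℝ (Fin d))} (hDom_convex : ∀ n, Convex ℝ (Dom n))
  (hDom_range : ∀ n, Set.range (S.stat n) ⊆ Dom n) (hA2 : S.HypDifferentiability Dom)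

include hA2

/-- Mean value inequality along segments of the convex domain; the derivative bound is uniform in
the point, hence so is the Lipschitz constant. -/
lemma norm_Q_sub_Q_le (hc : Convex ℝ (Dom n)) {φ : E (n + 1) → ℝ} (hφ : BddMeas φ) :
    ∃ C : ℝ, 0 ≤ C ∧ ∀ y, ∀ ξ ∈ Dom n, ∀ ξ' ∈ Dom n,
      |S.Q n ξ φ y - S.Q n ξ' φ y| ≤ C * ‖ξ - ξ'‖ := by
  obtain ⟨C, hC⟩ := hA2.bdd n φ hφ
  refine ⟨max C 0, le_max_right _ _, fun y ξ hξ ξ' hξ' => ?_⟩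
  exact hc.norm_image_sub_le_of_norm_fderiv_le (f := fun ζ => S.Q n ζ φ y) (𝕜 := ℝ)
    (fun z hz => hA2.diff n φ hφ y z hz) (fun z hz => (hC y z hz).trans (le_max_left _ _)) hξ' hξ

/-- First-order expansion of `ξ ↦ Q_{n+1,ξ} φ` at the limiting parameter, uniformly in space. -/
lemma norm_Q_sub_Q_sub_dQ_le (hc : Convex ℝ (Dom n)) (hm : S.limitParam n ∈ Dom n)
    {φ : E (n + 1) → ℝ} (hφ : BddMeas φ) {ε : ℝ} (hε : 0 < ε) :
    ∃ K : ℝ, 0 ≤ K ∧ ∀ y, ∀ ξ ∈ Dom n,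
      |S.Q n ξ φ y - S.Q n (S.limitParam n) φ y
        - S.dQ n (S.limitParam n) φ y (ξ - S.limitParam n)|
      ≤ ε * ‖ξ - S.limitParam n‖ + K * ‖ξ - S.limitParam n‖ ^ 2 := by
  obtain ⟨C, hC⟩ := hA2.bdd n φ hφ
  obtain ⟨C', hC'0, hC'⟩ := S.norm_Q_sub_Q_le hA2 hc hφ
  obtain ⟨δ, hδ, h⟩ := hA2.cont n φ hφ ε hε
  set ξ' := S.limitParam n
  -- Within distance `δ`, uniform continuity of the derivative gives the `ε` term. Beyond it, the
  -- crude linear bound is absorbed in the quadratic term, since there `‖ξ - ξ'‖ / δ ≥ 1`. That `K`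
  -- blows up as `ε → 0` is harmless, as the square has mean `O(1/N)`.
  refine ⟨(C' + max C 0) / δ, by positivity, fun y ξ hξ => ?_⟩
  by_cases hd : dist ξ ξ' < δ
  · have h1 := (hc.inter (convex_ball ξ' δ)).norm_image_sub_le_of_norm_fderiv_le' (𝕜 := ℝ)
      (f := fun ζ => S.Q n ζ φ y) (φ := S.dQ n ξ' φ y) (C := ε)
      (fun z hz => hA2.diff n φ hφ y z hz.1)
      (fun z hz => by
        have := h y z hz.1 hz.2
        rw [dist_eq_norm] at this
        exact this.le)
      (x := ξ') (y := ξ) ⟨hm, Metric.mem_ball_self hδ⟩ ⟨hξ, hd⟩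
    rw [Real.norm_eq_abs] at h1
    refine h1.trans (le_add_of_nonneg_right (by positivity))
  · rw [dist_eq_norm, not_lt] at hd
    have h1 := hC' y ξ hξ ξ' hm
    have h2 : |S.dQ n ξ' φ y (ξ - ξ')| ≤ max C 0 * ‖ξ - ξ'‖ := by
      rw [← Real.norm_eq_abs]
      exact (S.dQ n ξ' φ y).le_of_opNorm_le ((hC y ξ' hm).trans (le_max_left _ _)) _
    have h3 : (C' + max C 0) * ‖ξ - ξ'‖ ≤ (C' + max C 0) / δ * ‖ξ - ξ'‖ ^ 2 := by
      rw [div_mul_eq_mul_div, le_div_iff₀ hδ, sq, ← mul_assoc]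
      exact mul_le_mul_of_nonneg_left hd (by positivity)
    have h4 : 0 ≤ ε * ‖ξ - ξ'‖ := by positivity
    have h5 := abs_sub (S.Q n ξ φ y - S.Q n ξ' φ y) (S.dQ n ξ' φ y (ξ - ξ'))
    linarith

include hA1

/-- Directional derivatives are limits of difference quotients along `ξ + v / k`. These points may
leave `Dom`, but `Q` is measurable in space for every parameter. -/
lemma bddMeas_dQ_apply {ξ : EuclideanSpace ℝ (Fin d)} (hξ : ξ ∈ Dom n) {φ : E (n + 1) → ℝ}
    (hφ : BddMeas φ) (v : EuclideanSpace ℝ (Fin d)) : BddMeas (fun y => S.dQ n ξ φ y v) := by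
  obtain ⟨C, hC⟩ := hA2.bdd n φ hφ
  refine ⟨?_, C * ‖v‖, fun y => (S.dQ n ξ φ y).le_of_opNorm_le (hC y ξ hξ) v⟩
  refine measurable_of_tendsto_metrizable
    (f := fun (k : ℕ) y => (k : ℝ) • (S.Q n (ξ + (k : ℝ)⁻¹ • v) φ y - S.Q n ξ φ y))
    (fun k => (((S.bddMeas_Q _ hA1 hφ).1.sub (S.bddMeas_Q _ hA1 hφ).1).const_smul (k : ℝ)))
    (tendsto_pi_nhds.2 fun y => ?_)
  refine (hA2.diff n φ hφ y ξ hξ).hasFDerivAt.lim v ?_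
  simpa using tendsto_natCast_atTop_atTop

lemma integrable_dQ {ξ : EuclideanSpace ℝ (Fin d)} (hξ : ξ ∈ Dom n) {φ : E (n + 1) → ℝ}
    (hφ : BddMeas φ) (μ : Measure (E n)) [IsFiniteMeasure μ] :
    Integrable (fun y => S.dQ n ξ φ y) μ := by
  refine integrable_sum_clm (fun j => ContinuousLinearMap.toSpanSingleton ℝ
    (EuclideanSpace.proj j : EuclideanSpace ℝ (Fin d) →L[ℝ] ℝ))
    (fun j => (S.bddMeas_dQ_apply hA1 hA2 hξ hφ (EuclideanSpace.single j 1)).integrable μ)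
    fun y => ?_
  ext v
  rw [clm_apply_eq_sum]
  simp [mul_comm]

-- The assumptions speak of real test functions only; the vector-valued derivative is assembled from
-- its coordinates.
omit hA1 in
lemma hasFDerivAt_Q {r : ℕ} {ξ : EuclideanSpace ℝ (Fin d)} (hξ : ξ ∈ Dom n)
    {φ : E (n + 1) → EuclideanSpace ℝ (Fin r)} (hφ : BddMeas φ) (y : E n) :
    HasFDerivAt (fun ζ => S.Q n ζ φ y)
      (∑ i, ((ContinuousLinearMap.id ℝ ℝ).smulRight (EuclideanSpace.single i (1 : ℝ))).comp
        (S.dQ n ξ (fun z => φ z i) y)) ξ := by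
  have h : (fun ζ => S.Q n ζ φ y) = fun ζ => ∑ i, ((ContinuousLinearMap.id ℝ ℝ).smulRight
      (EuclideanSpace.single i (1 : ℝ))) (S.Q n ζ (fun z => φ z i) y) := by
    funext ζ
    have h2 : ∀ i, S.Q n ζ (fun z => φ z i) y = S.Q n ζ φ y i := fun i =>
      S.Q_clm_comp ζ hφ (EuclideanSpace.proj i : EuclideanSpace ℝ (Fin r) →L[ℝ] ℝ) y
    simp_rw [h2]
    conv_lhs => rw [← (EuclideanSpace.basisFun (Fin r) ℝ).sum_repr (S.Q n ζ φ y)]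
    simp
  rw [h]
  refine HasFDerivAt.fun_sum fun i _ => ?_
  exact (ContinuousLinearMap.hasFDerivAt _).comp ξ (hA2.diff n (fun z => φ z i)
    (hφ.clm_comp (EuclideanSpace.proj i : EuclideanSpace ℝ (Fin r) →L[ℝ] ℝ)) y ξ hξ).hasFDerivAt

lemma integrable_dQ_euclidean {r : ℕ} {ξ : EuclideanSpace ℝ (Fin d)} (hξ : ξ ∈ Dom n)
    {φ : E (n + 1) → EuclideanSpace ℝ (Fin r)} (hφ : BddMeas φ) (μ : Measure (E n))
    [IsFiniteMeasure μ] : Integrable (fun y => S.dQ n ξ φ y) μ := by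
  exact integrable_sum_clm (fun i => ContinuousLinearMap.compL ℝ (EuclideanSpace ℝ (Fin d)) ℝ
      (EuclideanSpace ℝ (Fin r)) ((ContinuousLinearMap.id ℝ ℝ).smulRight
        (EuclideanSpace.single i (1 : ℝ))))
    (fun i => S.integrable_dQ hA1 hA2 hξ (hφ.clm_comp
      (EuclideanSpace.proj i : EuclideanSpace ℝ (Fin r) →L[ℝ] ℝ)) μ)
    fun y => (S.hasFDerivAt_Q hA2 hξ hφ y).fderiv

/-- This is what lets Cramér–Wold pass through the recursion. -/
lemma L_clm_comp {r : ℕ} (hm : S.limitParam n ∈ Dom n)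
    {φ : E (n + 1) → EuclideanSpace ℝ (Fin r)} (hφ : BddMeas φ)
    (ℓ : EuclideanSpace ℝ (Fin r) →L[ℝ] ℝ) (x : E n) :
    S.L n (fun y => ℓ (φ y)) x = ℓ (S.L n φ x) := by
  have := S.isProbabilityMeasure_eta hA1 n
  have h1 : ∀ y, S.dQ n (S.limitParam n) (fun z => ℓ (φ z)) y
      = ContinuousLinearMap.compL ℝ (EuclideanSpace ℝ (Fin d)) (EuclideanSpace ℝ (Fin r)) ℝ ℓ
        (S.dQ n (S.limitParam n) φ y) := by
    intro y
    have h := ℓ.hasFDerivAt.comp (S.limitParam n)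
      (S.hasFDerivAt_Q hA2 hm hφ y).differentiableAt.hasFDerivAt
    have h2 : (fun ζ => S.Q n ζ (fun z => ℓ (φ z)) y) = ℓ ∘ fun ζ => S.Q n ζ φ y :=
      funext fun ζ => S.Q_clm_comp ζ hφ ℓ y
    rw [dQ, h2, h.fderiv]
    rfl
  simp only [L, h1]
  rw [ContinuousLinearMap.integral_comp_comm _ (S.integrable_dQ_euclidean hA1 hA2 hm hφ _),
    S.Q_clm_comp _ hφ, map_add]
  rfl

end Deriv
end AdaptiveSMC

/-! ### Mean square convergence at rate `1 / √N` -/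

/-- A family of integrable functions of `N` points whose means are at most of order `1 / N`. -/
structure MeanBigOInv {α : Type*} [MeasurableSpace α] (m : ∀ N, Measure (Fin N → α))
    (W : ∀ N, (Fin N → α) → ℝ) : Prop where
  integrable : ∀ N, 0 < N → Integrable (W N) (m N)
  bound : ∃ C : ℝ, ∀ N : ℕ, 0 < N → ∫ x, W N x ∂(m N) ≤ C / N

namespace MeanBigOInv

variable {α : Type*} [MeasurableSpace α] {m : ∀ N, Measure (Fin N → α)}
  {W W' : ∀ N, (Fin N → α) → ℝ}

lemma add (h : MeanBigOInv m W) (h' : MeanBigOInv m W') :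
    MeanBigOInv m (fun N x => W N x + W' N x) := by
  obtain ⟨C, hC⟩ := h.bound
  obtain ⟨C', hC'⟩ := h'.bound
  refine ⟨fun N hN => (h.integrable N hN).add (h'.integrable N hN), C + C', fun N hN => ?_⟩
  rw [integral_add (h.integrable N hN) (h'.integrable N hN), add_div]
  exact add_le_add (hC N hN) (hC' N hN)

lemma const_mul (h : MeanBigOInv m W) {c : ℝ} (hc : 0 ≤ c) :
    MeanBigOInv m (fun N x => c * W N x) := by
  obtain ⟨C, hC⟩ := h.bound
  refine ⟨fun N hN => (h.integrable N hN).const_mul c, c * C, fun N hN => ?_⟩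
  rw [integral_const_mul, mul_div_assoc]
  exact mul_le_mul_of_nonneg_left (hC N hN) hc

lemma sum {ι : Type*} (s : Finset ι) {W : ι → ∀ N, (Fin N → α) → ℝ}
    (h : ∀ i, MeanBigOInv m (W i)) : MeanBigOInv m (fun N x => ∑ i ∈ s, W i N x) := by
  choose C hC using fun i => (h i).bound
  refine ⟨fun N hN => integrable_finsetSum _ fun i _ => (h i).integrable N hN, ∑ i ∈ s, C i,
    fun N hN => ?_⟩
  rw [integral_finsetSum _ fun i _ => (h i).integrable N hN, Finset.sum_div]
  exact Finset.sum_le_sum fun i _ => hC i N hN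

end MeanBigOInv

lemma abs_exp_neg_sub_exp_neg_le {a b : ℝ} (ha : 0 ≤ a) (hb : 0 ≤ b) :
    |Real.exp (-a) - Real.exp (-b)| ≤ |a - b| := by
  wlog h : a ≤ b generalizing a b
  · rw [abs_sub_comm, abs_sub_comm a b]
    exact this hb ha (le_of_not_ge h)
  have h1 : Real.exp (-b) ≤ Real.exp (-a) := Real.exp_le_exp.2 (by linarith)
  rw [abs_of_nonneg (sub_nonneg.2 h1), abs_sub_comm, abs_of_nonneg (sub_nonneg.2 h)]
  have h2 : Real.exp (-b) = Real.exp (-a) * Real.exp (-(b - a)) := by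
    rw [← Real.exp_add]; congr 1; ring
  have h3 := Real.add_one_le_exp (-(b - a))
  have h4 : Real.exp (-a) ≤ 1 := Real.exp_le_one_iff.2 (by linarith)
  have h5 := Real.exp_pos (-a)
  have h6 : Real.exp (-(b - a)) ≤ 1 := Real.exp_le_one_iff.2 (by linarith)
  nlinarith

lemma norm_cexp_I_mul_sub_le (u v : ℝ) :
    ‖Complex.exp (Complex.I * u) - Complex.exp (Complex.I * v)‖ ≤ |u - v| := by
  have h : Complex.exp (Complex.I * u) - Complex.exp (Complex.I * v)
      = Complex.exp (Complex.I * v) * (Complex.exp (Complex.I * ↑(u - v)) - 1) := by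
    rw [mul_sub, ← Complex.exp_add, mul_one]
    congr 2
    push_cast
    ring
  rw [h, norm_mul, mul_comm, mul_comm Complex.I (v : ℂ), Complex.norm_exp_ofReal_mul_I, mul_one]
  exact Real.norm_exp_I_mul_ofReal_sub_one_le

lemma integral_sq_sub_integral {α : Type*} [MeasurableSpace α] (ν : Measure α)
    [IsProbabilityMeasure ν] {φ : α → ℝ} (hφ : BddMeas φ) :
    ∫ y, (φ y - ∫ z, φ z ∂ν) ^ 2 ∂ν = ∫ y, φ y ^ 2 ∂ν - (∫ z, φ z ∂ν) ^ 2 := by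
  set m := ∫ z, φ z ∂ν with hm
  have h : ∀ y, (φ y - m) ^ 2 = φ y ^ 2 - (2 * m * φ y - m ^ 2) := fun y => by ring
  have hi : Integrable (fun y => 2 * m * φ y - m ^ 2) ν :=
    ((hφ.integrable ν).const_mul _).sub (integrable_const _)
  simp_rw [h]
  rw [integral_sub (hφ.sq.integrable ν) hi,
    integral_sub ((hφ.integrable ν).const_mul _) (integrable_const _), integral_const_mul, ← hm]
  simp
  ring

lemma sq_norm_integral_sub_le {α : Type*} [MeasurableSpace α] (ν : Measure α)
    [IsProbabilityMeasure ν] {φ : α → ℝ} {K : ℝ} (hφ : BddMeas φ) (hK : ∀ y, ‖φ y‖ ≤ K) :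
    ∫ y, (φ y - ∫ z, φ z ∂ν) ^ 2 ∂ν ≤ K ^ 2 := by
  rw [integral_sq_sub_integral ν hφ]
  have h : ∫ y, φ y ^ 2 ∂ν ≤ ∫ y, K ^ 2 ∂ν := by
    refine integral_mono (hφ.sq.integrable ν) (integrable_const _) fun y => ?_
    have := pow_le_pow_left₀ (norm_nonneg _) (hK y) 2
    simpa using this
  simp only [integral_const, probReal_univ, one_smul] at h
  nlinarith [sq_nonneg (∫ z, φ z ∂ν)]

namespace AdaptiveSMC

variable {d : ℕ} {E : ℕ → Type*} [∀ n, MeasurableSpace (E n)]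

section MeanSquare

variable (S : AdaptiveSMC d E) (hA1 : S.HypContinuity) {n : ℕ}
  {Dom : ℕ → Set (EuclideanSpace ℝ (Fin d))} (hDom_convex : ∀ n, Convex ℝ (Dom n))
  (hDom_range : ∀ n, Set.range (S.stat n) ⊆ Dom n) (hA2 : S.HypDifferentiability Dom)
  {m : ∀ N, Measure (Fin N → E n)}

/-- The empirical means of `N` points of law `m N` are within `O(1 / √N)` in mean square of the
means under `η_n`. -/
def MeanSquareRate (n : ℕ) (m : ∀ N, Measure (Fin N → E n)) : Prop :=
  ∀ φ : E n → ℝ, BddMeas φ →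
    MeanBigOInv m (fun _ x => (empMean φ x - ∫ y, φ y ∂(S.eta n)) ^ 2)

variable (hm : S.MeanSquareRate n m)

include hA1 hm

lemma MeanSquareRate.stat :
    MeanBigOInv m (fun _ x => ‖empMean (S.stat n) x - S.limitParam n‖ ^ 2) := by
  have := S.isProbabilityMeasure_eta hA1 n
  have h := MeanBigOInv.sum Finset.univ (fun j : Fin d => hm (fun y => S.stat n y j)
    ((S.bddMeas_stat hA1 n).clm_comp
      (EuclideanSpace.proj j : EuclideanSpace ℝ (Fin d) →L[ℝ] ℝ)))
  convert h using 4 with N x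
  rw [EuclideanSpace.real_norm_sq_eq]
  refine Finset.sum_congr rfl fun j _ => ?_
  have h1 : empMean (S.stat n) x j = empMean (fun y => S.stat n y j) x := map_empMean
    (EuclideanSpace.proj j : EuclideanSpace ℝ (Fin d) →L[ℝ] ℝ).toLinearMap (S.stat n) x
  have h2 : ∫ y, S.stat n y j ∂(S.eta n) = (∫ y, S.stat n y ∂(S.eta n)) j :=
    (EuclideanSpace.proj j : EuclideanSpace ℝ (Fin d) →L[ℝ] ℝ).integral_comp_comm
    ((S.bddMeas_stat hA1 n).integrable (S.eta n))
  rw [← S.limitParam_eq] at h2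
  rw [PiLp.sub_apply, h1, h2]

include hA2 hDom_convex hDom_range

/-- The error splits into a change of parameter, Lipschitz in the error of the statistic, and the
error at the fixed parameter. Stating it through a majorant `W` means that only `W` has to be
integrable. -/
lemma MeanSquareRate.exists_empMean_Q {φ : E (n + 1) → ℝ} (hφ : BddMeas φ) :
    ∃ W, MeanBigOInv m W ∧ ∀ N, 0 < N → ∀ x : Fin N → E n,
      (empMean (S.Q n (empMean (S.stat n) x) φ) x
        - ∫ y, S.Q n (S.limitParam n) φ y ∂(S.eta n)) ^ 2 ≤ W N x := by
  obtain ⟨C, hC0, hC⟩ := S.norm_Q_sub_Q_le hA2 (hDom_convex n) hφ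
  have hmem := S.limitParam_mem hA1 n (hDom_convex n) (hDom_range n)
  refine ⟨_, ((hm _ (S.bddMeas_Q (S.limitParam n) hA1 hφ)).const_mul zero_le_two).add
    ((hm.stat S hA1).const_mul (c := 2 * C ^ 2) (by positivity)), fun N hN x => ?_⟩
  have h1 : ‖empMean (fun y => S.Q n (empMean (S.stat n) x) φ y - S.Q n (S.limitParam n) φ y) x‖
      ≤ C * ‖empMean (S.stat n) x - S.limitParam n‖ := norm_empMean_le hN
    (fun y => hC y _ (S.empMean_stat_mem hDom_convex hDom_range hN x) _ hmem) x
  rw [empMean_sub, Real.norm_eq_abs] at h1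
  have h2 := pow_le_pow_left₀ (abs_nonneg _) h1 2
  rw [sq_abs] at h2
  nlinarith [sq_nonneg ((empMean (S.Q n (empMean (S.stat n) x) φ) x
    - empMean (S.Q n (S.limitParam n) φ) x) - (empMean (S.Q n (S.limitParam n) φ) x
    - ∫ y, S.Q n (S.limitParam n) φ y ∂(S.eta n)))]

lemma MeanSquareRate.exists_empMean_G :
    ∃ W, MeanBigOInv m W ∧ ∀ N, 0 < N → ∀ x : Fin N → E n,
      (empMean (S.G n (empMean (S.stat n) x)) x - ∫ y, S.limG n y ∂(S.eta n)) ^ 2 ≤ W N x := by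
  obtain ⟨W, hW, h⟩ := hm.exists_empMean_Q S hA1 hDom_convex hDom_range hA2 (BddMeas.const 1)
  simp only [Q_one] at h
  exact ⟨W, hW, h⟩

lemma MeanSquareRate.exists_PhiN {φ : E (n + 1) → ℝ} (hφ : BddMeas φ) :
    ∃ W, MeanBigOInv m W ∧ ∀ N, 0 < N → ∀ x : Fin N → E n,
      (∫ y, φ y ∂(S.PhiN n x) - ∫ y, φ y ∂(S.eta (n + 1))) ^ 2 ≤ W N x := by
  have := S.isProbabilityMeasure_eta hA1 n
  obtain ⟨W₁, hW₁, h₁⟩ := hm.exists_empMean_Q S hA1 hDom_convex hDom_range hA2 hφ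
  obtain ⟨W₂, hW₂, h₂⟩ := hm.exists_empMean_G S hA1 hDom_convex hDom_range hA2
  obtain ⟨K, hK⟩ := hφ.2
  have ha : 0 < ∫ y, S.limG n y ∂(S.eta n) := S.integral_G_pos hA1 _ _
  refine ⟨_, (hW₁.add (hW₂.const_mul (sq_nonneg K))).const_mul
    (c := 2 * (∫ y, S.limG n y ∂(S.eta n))⁻¹ ^ 2) (by positivity), fun N hN x => ?_⟩
  have hpr := S.isProbabilityMeasure_PhiN hA1 hN x
  have e1 := h₁ N hN x
  have e2 := h₂ N hN x
  have hle : |∫ y, φ y ∂(S.PhiN n x)| ≤ K :=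
    (norm_integral_le_of_norm_le_const (ae_of_all _ hK)).trans (by simp)
  have ha' := empMean_pos hN (S.G_pos n (empMean (S.stat n) x)) x
  rw [S.integral_eta_succ hA1 n hφ, smul_eq_mul]
  have hP := S.integral_PhiN hA1 hN hφ x
  set p := ∫ y, φ y ∂(S.PhiN n x)
  set a := ∫ y, S.limG n y ∂(S.eta n)
  set a' := empMean (S.G n (empMean (S.stat n) x)) x
  set A := ∫ y, S.Q n (S.limitParam n) φ y ∂(S.eta n)
  set A' := empMean (S.Q n (empMean (S.stat n) x) φ) x
  have hA : A' = a' * p := by rw [hP]; field_simp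
  -- This form of the difference of ratios divides by the deterministic `a` only. The random `a'`
  -- has no positive lower bound, but `p` is bounded by `K` anyway.
  have hid : p - a⁻¹ * A = a⁻¹ * ((A' - A) - p * (a' - a)) := by
    rw [hA]; field_simp; ring
  rw [hid, mul_pow, mul_comm 2, mul_assoc]
  refine mul_le_mul_of_nonneg_left ?_ (by positivity)
  have h3 : p ^ 2 ≤ K ^ 2 := by
    rw [← sq_abs]
    exact pow_le_pow_left₀ (abs_nonneg _) hle 2
  have h4 : p ^ 2 * (a' - a) ^ 2 ≤ K ^ 2 * W₂ N x := mul_le_mul h3 e2 (sq_nonneg _) (sq_nonneg _)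
  nlinarith [sq_nonneg ((A' - A) + p * (a' - a))]

end MeanSquare

section Law

variable {S : AdaptiveSMC d E} (hA1 : S.HypContinuity) {n N : ℕ}
  {Dom : ℕ → Set (EuclideanSpace ℝ (Fin d))} (hDom_convex : ∀ n, Convex ℝ (Dom n))
  (hDom_range : ∀ n, Set.range (S.stat n) ⊆ Dom n) (hA2 : S.HypDifferentiability Dom)
  {μ : ∀ n N, Measure (Fin N → E n)} (hμ : S.IsParticleLaw μ)

include hA1 hDom_convex hDom_range hA2 hμ

/-- Mean square convergence of the particle approximation at rate `1 / √N`. -/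
theorem IsParticleLaw.meanSquareRate (n : ℕ) : S.MeanSquareRate n (μ n) := by
  have hint : ∀ n, ∀ φ : E n → ℝ, BddMeas φ → ∀ N, 0 < N →
      Integrable (fun x : Fin N → E n => (empMean φ x - ∫ y, φ y ∂(S.eta n)) ^ 2) (μ n N) := by
    intro n φ hφ N hN
    have := hμ.prob n N
    obtain ⟨C, hC⟩ := hφ.2
    have hb : BddMeas (empMean φ : (Fin N → E n) → ℝ) :=
      ⟨measurable_empMean hφ.1, C, norm_empMean_le hN hC⟩
    exact (hb.sub_const _).sq.integrable _
  induction n with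
  | zero =>
    intro φ hφ
    obtain ⟨K, hK⟩ := hφ.2
    refine ⟨hint 0 φ hφ, K ^ 2, fun N hN => ?_⟩
    rw [hμ.zero, integral_sq_empMean_sub hφ hN, eta_zero, sub_self, zero_pow two_ne_zero, zero_add]
    exact div_le_div_of_nonneg_right (sq_norm_integral_sub_le _ hφ hK) (Nat.cast_nonneg _)
  | succ n ih =>
    intro φ hφ
    obtain ⟨K, hK⟩ := hφ.2
    -- Conditional bias and variance: the bias of `PhiN` is handled by the previous time, and the
    -- sampling variance is at most `K ^ 2 / N`.
    obtain ⟨W, hW, h⟩ := ih.exists_PhiN S hA1 hDom_convex hDom_range hA2 hφ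
    obtain ⟨C, hC⟩ := hW.bound
    refine ⟨hint (n + 1) φ hφ, C + K ^ 2, fun N hN => ?_⟩
    have := hμ.prob n N
    rw [hμ.integral_sq_succ hA1 hDom_convex hDom_range hA2 hN hφ]
    refine (integral_mono_of_nonneg (ae_of_all _ fun x => ?_)
      ((hW.integrable N hN).add (integrable_const (K ^ 2 / N))) (ae_of_all _ fun x => ?_)).trans ?_
    · have : 0 ≤ ∫ y, (φ y - ∫ z, φ z ∂(S.PhiN n x)) ^ 2 ∂(S.PhiN n x) :=
        integral_nonneg fun y => sq_nonneg _
      simp only [Pi.zero_apply]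
      positivity
    · have := S.isProbabilityMeasure_PhiN hA1 hN x
      exact add_le_add (h N hN x)
        (div_le_div_of_nonneg_right (sq_norm_integral_sub_le _ hφ hK) (Nat.cast_nonneg _))
    · simp only [Pi.add_apply]
      rw [integral_add (hW.integrable N hN) (integrable_const _), add_div]
      simpa using hC N hN

end Law

end AdaptiveSMC

/-! ### Linearization of the conditional mean -/

namespace AdaptiveSMC

variable {d : ℕ} {E : ℕ → Type*} [∀ n, MeasurableSpace (E n)]

section Linearization

variable (S : AdaptiveSMC d E) (hA1 : S.HypContinuity) {n : ℕ}
  {Dom : ℕ → Set (EuclideanSpace ℝ (Fin d))} (hDom_convex : ∀ n, Convex ℝ (Dom n))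
  (hDom_range : ∀ n, Set.range (S.stat n) ⊆ Dom n) (hA2 : S.HypDifferentiability Dom)
  {m : ∀ N, Measure (Fin N → E n)} (hm : S.MeanSquareRate n m)

include hA1 hDom_convex hDom_range hA2 hm

/-- The fluctuations of the empirical mean of the derivative are of second order. -/
lemma MeanSquareRate.exists_empMean_dQ {φ : E (n + 1) → ℝ} (hφ : BddMeas φ) :
    ∃ W, MeanBigOInv m W ∧ ∀ N, 0 < N → ∀ x : Fin N → E n,
      |empMean (fun y => S.dQ n (S.limitParam n) φ y (empMean (S.stat n) x - S.limitParam n)) x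
        - (∫ y, S.dQ n (S.limitParam n) φ y ∂(S.eta n)) (empMean (S.stat n) x - S.limitParam n)|
      ≤ W N x := by
  have := S.isProbabilityMeasure_eta hA1 n
  have hmem := S.limitParam_mem hA1 n (hDom_convex n) (hDom_range n)
  have hb := fun j : Fin d =>
    S.bddMeas_dQ_apply hA1 hA2 hmem hφ (EuclideanSpace.single j (1 : ℝ))
  -- In coordinates the error is a sum of products of two fluctuations, that of the statistic and
  -- that of a partial derivative; `|a b| ≤ a² + b²` bounds it by squares of mean `O(1/N)`.
  refine ⟨_, (hm.stat S hA1).add (MeanBigOInv.sum Finset.univ fun j => hm _ (hb j)),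
    fun N hN x => ?_⟩
  set v := empMean (S.stat n) x - S.limitParam n with hv
  set B := ∫ y, S.dQ n (S.limitParam n) φ y ∂(S.eta n) with hB
  have h1 : ∀ j, B (EuclideanSpace.single j 1)
      = ∫ y, S.dQ n (S.limitParam n) φ y (EuclideanSpace.single j 1) ∂(S.eta n) := fun j =>
    ContinuousLinearMap.integral_apply (S.integrable_dQ hA1 hA2 hmem hφ _) _
  have h2 : empMean (fun y => S.dQ n (S.limitParam n) φ y v) x
      = ∑ j, v j * empMean
        (fun y => S.dQ n (S.limitParam n) φ y (EuclideanSpace.single j 1)) x := by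
    have : (fun y => S.dQ n (S.limitParam n) φ y v) = fun y => ∑ j, v j •
        S.dQ n (S.limitParam n) φ y (EuclideanSpace.single j 1) :=
      funext fun y => clm_apply_eq_sum _ v
    rw [this]
    simp only [empMean, smul_eq_mul, Finset.mul_sum]
    rw [Finset.sum_comm]
    refine Finset.sum_congr rfl fun j _ => Finset.sum_congr rfl fun i _ => by ring
  rw [h2, clm_apply_eq_sum B v, ← Finset.sum_sub_distrib, EuclideanSpace.real_norm_sq_eq,
    ← Finset.sum_add_distrib]
  refine (Finset.abs_sum_le_sum_abs _ _).trans (Finset.sum_le_sum fun j _ => ?_)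
  rw [h1, smul_eq_mul, ← mul_sub, abs_mul]
  set u := empMean (fun y => S.dQ n (S.limitParam n) φ y (EuclideanSpace.single j 1)) x
    - ∫ y, S.dQ n (S.limitParam n) φ y (EuclideanSpace.single j 1) ∂(S.eta n)
  rw [← sq_abs (v j), ← sq_abs u]
  nlinarith [sq_nonneg (|v j| - |u|), abs_nonneg (v j), abs_nonneg u]

/-- Linearization of the conditional mean of the particles at time `n + 1`. -/
lemma MeanSquareRate.exists_PhiN_sub_L {φ : E (n + 1) → ℝ} (hφ : BddMeas φ)
    (h0 : ∫ y, φ y ∂(S.eta (n + 1)) = 0) {ε : ℝ} (hε : 0 < ε) :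
    ∃ W, MeanBigOInv m W ∧ ∀ N, 0 < N → ∀ x : Fin N → E n,
      |∫ y, φ y ∂(S.PhiN n x)
        - empMean (fun y => (∫ z, S.limG n z ∂(S.eta n))⁻¹ * S.L n φ y) x|
      ≤ ε * ‖empMean (S.stat n) x - S.limitParam n‖ + W N x := by
  have := S.isProbabilityMeasure_eta hA1 n
  have ha : 0 < ∫ y, S.limG n y ∂(S.eta n) := S.integral_G_pos hA1 _ _
  have hmem := S.limitParam_mem hA1 n (hDom_convex n) (hDom_range n)
  -- The expansion is taken at precision `a * ε`, so that division by the normalisation `a` leaves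
  -- `ε`.
  obtain ⟨K, hK0, hK⟩ := S.norm_Q_sub_Q_sub_dQ_le hA2 (hDom_convex n) hmem hφ (mul_pos ha hε)
  obtain ⟨W₁, hW₁, h₁⟩ := hm.exists_empMean_dQ S hA1 hDom_convex hDom_range hA2 hφ
  obtain ⟨W₂, hW₂, h₂⟩ := hm.exists_empMean_G S hA1 hDom_convex hDom_range hA2
  obtain ⟨W₃, hW₃, h₃⟩ := hm.exists_PhiN S hA1 hDom_convex hDom_range hA2 hφ
  refine ⟨_, ((((hm.stat S hA1).const_mul hK0).add hW₁).add (hW₂.add hW₃)).const_mul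
    (inv_nonneg.2 ha.le), fun N hN x => ?_⟩
  have e1 := h₁ N hN x
  have e2 := h₂ N hN x
  have e3 := h₃ N hN x
  rw [h0, sub_zero] at e3
  have ha' := empMean_pos hN (S.G_pos n (empMean (S.stat n) x)) x
  have hP := S.integral_PhiN hA1 hN hφ x
  have hξ := S.empMean_stat_mem hDom_convex hDom_range hN x
  have hR : |empMean (fun y => S.Q n (empMean (S.stat n) x) φ y - S.Q n (S.limitParam n) φ y
      - S.dQ n (S.limitParam n) φ y (empMean (S.stat n) x - S.limitParam n)) x|
      ≤ (∫ y, S.limG n y ∂(S.eta n)) * ε * ‖empMean (S.stat n) x - S.limitParam n‖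
        + K * ‖empMean (S.stat n) x - S.limitParam n‖ ^ 2 := by
    rw [← Real.norm_eq_abs]
    exact norm_empMean_le hN (fun y => hK y _ hξ) x
  rw [empMean_sub, empMean_sub] at hR
  have hL : empMean (S.L n φ) x = (∫ z, S.dQ n (S.limitParam n) φ z ∂(S.eta n))
      (empMean (S.stat n) x - S.limitParam n) + empMean (S.Q n (S.limitParam n) φ) x := by
    unfold L
    rw [empMean_add, ← empMean_sub_const hN, ← S.limitParam_eq]
    congr 1
    exact (map_empMean (∫ z, S.dQ n (S.limitParam n) φ z ∂(S.eta n)).toLinearMap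
      (fun y => S.stat n y - S.limitParam n) x).symm
  have hc : empMean (fun y => (∫ z, S.limG n z ∂(S.eta n))⁻¹ * S.L n φ y) x
      = (∫ z, S.limG n z ∂(S.eta n))⁻¹ * empMean (S.L n φ) x := by
    simp only [empMean, smul_eq_mul, ← Finset.mul_sum]
    ring
  rw [hc, hL]
  set p := ∫ y, φ y ∂(S.PhiN n x)
  set a := ∫ y, S.limG n y ∂(S.eta n)
  set a' := empMean (S.G n (empMean (S.stat n) x)) x
  set A' := empMean (S.Q n (empMean (S.stat n) x) φ) x
  set A := empMean (S.Q n (S.limitParam n) φ) x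
  set v := empMean (S.stat n) x - S.limitParam n
  set D := empMean (fun y => S.dQ n (S.limitParam n) φ y v) x
  set B := (∫ z, S.dQ n (S.limitParam n) φ z ∂(S.eta n)) v
  have hA : A' = a' * p := by rw [hP]; field_simp
  have hid : p - a⁻¹ * (B + A) = a⁻¹ * ((A' - A - D) + (D - B) - p * (a' - a)) := by
    rw [hA]; field_simp; ring
  have hid2 : ε * ‖v‖ = a⁻¹ * (a * ε * ‖v‖) := by field_simp
  rw [hid, abs_mul, abs_of_pos (inv_pos.2 ha), hid2, ← mul_add]
  refine mul_le_mul_of_nonneg_left ?_ (inv_nonneg.2 ha.le)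
  -- Since `η_{n+1}(φ) = 0`, `p` is itself a fluctuation and this product is of second order. This
  -- is why the derivative of `G` does not appear in `𝓛`, apart from its part in `Q`.
  have hprod : |p * (a' - a)| ≤ W₂ N x + W₃ N x := by
    rw [abs_mul]
    rw [← sq_abs] at e2 e3
    nlinarith [sq_nonneg (|p| - |a' - a|), abs_nonneg p, abs_nonneg (a' - a)]
  have t1 := abs_sub ((A' - A - D) + (D - B)) (p * (a' - a))
  have t2 := abs_add_le (A' - A - D) (D - B)
  linarith

end Linearization

/-! ### Central limit theorem for real test functions -/

/-- The asymptotic variance of the particle approximation, by recursion on time. -/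
def asympVar (S : AdaptiveSMC d E) : ∀ n, (E n → ℝ) → ℝ
  | 0, φ => ∫ y, (φ y - ∫ z, φ z ∂(S.eta 0)) ^ 2 ∂(S.eta 0)
  | n + 1, φ => ∫ y, (φ y - ∫ z, φ z ∂(S.eta (n + 1))) ^ 2 ∂(S.eta (n + 1))
      + asympVar S n (fun x => (∫ z, S.limG n z ∂(S.eta n))⁻¹ *
        S.L n (fun y => φ y - ∫ z, φ z ∂(S.eta (n + 1))) x)

section CLT

variable {S : AdaptiveSMC d E} (hA1 : S.HypContinuity) {n N : ℕ}
  {Dom : ℕ → Set (EuclideanSpace ℝ (Fin d))} (hDom_convex : ∀ n, Convex ℝ (Dom n))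
  (hDom_range : ∀ n, Set.range (S.stat n) ⊆ Dom n) (hA2 : S.HypDifferentiability Dom)
  {μ : ∀ n N, Measure (Fin N → E n)} (hμ : S.IsParticleLaw μ)

include hA1 hDom_convex hDom_range hA2 hμ

/-- The induction step in quantitative form. `C₁` is chosen before `ε` and `C₂` after it: letting `N
→ ∞` first and then `ε → 0` removes both errors. -/
lemma IsParticleLaw.norm_integral_cexp_succ_sub_le {φ : E (n + 1) → ℝ} (hφ : BddMeas φ)
    (h0 : ∫ y, φ y ∂(S.eta (n + 1)) = 0) :
    ∃ C₁ : ℝ, ∀ ε > 0, ∃ C₂ : ℝ, ∀ N : ℕ, 0 < N →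
      ‖∫ y, Complex.exp (Complex.I * ↑(√(N : ℝ) * empMean φ y)) ∂(μ (n + 1) N)
        - (∫ x, Complex.exp (Complex.I * ↑(√(N : ℝ) *
          empMean (fun y => (∫ z, S.limG n z ∂(S.eta n))⁻¹ * S.L n φ y) x)) ∂(μ n N))
          * Complex.exp (-((∫ y, φ y ^ 2 ∂(S.eta (n + 1))) / 2 : ℝ))‖
      ≤ ε * C₁ + C₂ * (√(N : ℝ))⁻¹ := by
  have hm := hμ.meanSquareRate hA1 hDom_convex hDom_range hA2 n
  obtain ⟨C₁, hC₁⟩ := (hm.stat S hA1).bound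
  obtain ⟨K, hK⟩ := hφ.2
  obtain ⟨W₃, hW₃, h₃⟩ := hm.exists_PhiN S hA1 hDom_convex hDom_range hA2 hφ
  obtain ⟨W₄, hW₄, h₄⟩ := hm.exists_PhiN S hA1 hDom_convex hDom_range hA2 hφ.sq
  refine ⟨1 + C₁, fun ε hε => ?_⟩
  obtain ⟨W₂, hW₂, h₂⟩ := hm.exists_PhiN_sub_L S hA1 hDom_convex hDom_range hA2 hφ h0 hε
  have hW := (hW₂.add hW₃).add hW₄
  obtain ⟨C₂, hC₂⟩ := hW.bound
  set K₀ := (2 * K) ^ 3 * Real.exp (2 * K) + (2 * K) ^ 4 * Real.exp ((2 * K) ^ 2) with hK₀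
  refine ⟨K₀ + 1 + C₂, fun N hN => ?_⟩
  have hprμ := hμ.prob n N
  have hNr : (0 : ℝ) < N := by exact_mod_cast hN
  have hs : 0 < √(N : ℝ) := Real.sqrt_pos.2 hNr
  have hss : √(N : ℝ) * √(N : ℝ) = N := Real.mul_self_sqrt hNr.le
  have h1N : 1 ≤ √(N : ℝ) := by
    rw [Real.one_le_sqrt]
    exact_mod_cast hN
  set ψ : E n → ℝ := fun y => (∫ z, S.limG n z ∂(S.eta n))⁻¹ * S.L n φ y with hψ
  have hψb : BddMeas ψ := (S.bddMeas_L hA1 hφ).const_mul _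
  set V := ∫ y, φ y ^ 2 ∂(S.eta (n + 1)) with hV
  have hV0 : 0 ≤ V := integral_nonneg fun y => sq_nonneg _
  have hpt : ∀ x : Fin N → E n,
      ‖(∫ y, Complex.exp (Complex.I * ↑((√(N : ℝ))⁻¹ * φ y)) ∂(S.PhiN n x)) ^ N
        - Complex.exp (Complex.I * ↑(√(N : ℝ) * empMean ψ x)) * Complex.exp (-(V / 2 : ℝ))‖
      ≤ (√(N : ℝ))⁻¹ * (K₀ + 1)
        + (ε * (1 + N * ‖empMean (S.stat n) x - S.limitParam n‖ ^ 2)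
          + √(N : ℝ) * (W₂ N x + W₃ N x + W₄ N x)) := by
    intro x
    have hpr := S.isProbabilityMeasure_PhiN hA1 hN x
    have e1 := norm_integral_cexp_pow_sub_le (ν := S.PhiN n x) hφ.1 hK hN
    have e2 := h₂ N hN x
    have e3 := h₃ N hN x
    have e4 := h₄ N hN x
    rw [h0, sub_zero] at e3
    set p := ∫ y, φ y ∂(S.PhiN n x)
    have hVx0 : 0 ≤ ∫ y, (φ y - p) ^ 2 ∂(S.PhiN n x) := integral_nonneg fun y => sq_nonneg _
    have hVx := integral_sq_sub_integral (S.PhiN n x) hφ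
    set Vx := ∫ y, (φ y - p) ^ 2 ∂(S.PhiN n x)
    set q := ∫ y, φ y ^ 2 ∂(S.PhiN n x)
    have hVd : |Vx - V| ≤ (√(N : ℝ))⁻¹ + √(N : ℝ) * (W₃ N x + W₄ N x) := by
      -- Only the square of `q - V` is controlled, so the inequality `2 |q - V| ≤ 1/√N + √N |q -
      -- V|²` is used; the right side has mean `O(1/√N)`.
      have b1 : |q - V| ≤ (√(N : ℝ))⁻¹ + √(N : ℝ) * W₄ N x := by
        have c1 : √(N : ℝ) * |q - V| ^ 2 ≤ √(N : ℝ) * W₄ N x := by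
          rw [sq_abs]
          exact mul_le_mul_of_nonneg_left e4 hs.le
        have c2 : (√(N : ℝ))⁻¹ * √(N : ℝ) = 1 := inv_mul_cancel₀ hs.ne'
        have c3 : |q - V| = (√(N : ℝ))⁻¹ * (√(N : ℝ) * |q - V|) := by
          rw [← mul_assoc, c2, one_mul]
        have c4 : 0 ≤ (√(N : ℝ))⁻¹ * (√(N : ℝ) * |q - V| - 1) ^ 2 := by positivity
        have c5 : (√(N : ℝ))⁻¹ * (√(N : ℝ) * |q - V| - 1) ^ 2
            = √(N : ℝ) * |q - V| ^ 2 - 2 * |q - V| + (√(N : ℝ))⁻¹ := by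
          field_simp
          ring
        have c6 := abs_nonneg (q - V)
        linarith
      have b2 : |p ^ 2| ≤ √(N : ℝ) * W₃ N x := by
        rw [abs_of_nonneg (sq_nonneg p)]
        nlinarith [sq_nonneg p]
      have b3 : Vx - V = (q - V) - p ^ 2 := by rw [hVx]; ring
      rw [b3]
      have := abs_sub (q - V) (p ^ 2)
      linarith
    have hmd : |√(N : ℝ) * p - √(N : ℝ) * empMean ψ x|
        ≤ ε * (1 + N * ‖empMean (S.stat n) x - S.limitParam n‖ ^ 2) + √(N : ℝ) * W₂ N x := by
      rw [← mul_sub, abs_mul, abs_of_pos hs]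
      refine (mul_le_mul_of_nonneg_left e2 hs.le).trans ?_
      set D := ‖empMean (S.stat n) x - S.limitParam n‖
      -- The norm is traded for its square, whose mean times `N` is bounded independently of `ε`;
      -- this produces `C₁`.
      have c1 : √(N : ℝ) * D ≤ 1 + N * D ^ 2 := by
        have c2 : (N : ℝ) * D ^ 2 = (√(N : ℝ) * D) ^ 2 := by rw [mul_pow, sq (√(N : ℝ)), hss]
        rw [c2]
        nlinarith [sq_nonneg (√(N : ℝ) * D - 1), sq_nonneg (√(N : ℝ) * D)]
      nlinarith
    have hexpV : ‖Complex.exp (-(Vx / 2 : ℝ)) - Complex.exp (-(V / 2 : ℝ))‖ ≤ |Vx - V| := by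
      rw [← Complex.ofReal_neg, ← Complex.ofReal_neg, ← Complex.ofReal_exp, ← Complex.ofReal_exp,
        ← Complex.ofReal_sub, Complex.norm_real, Real.norm_eq_abs]
      refine (abs_exp_neg_sub_exp_neg_le (by positivity) (by positivity)).trans ?_
      rw [← sub_div, abs_div, abs_two]
      linarith [abs_nonneg (Vx - V)]
    have hV1 : ‖Complex.exp (-(V / 2 : ℝ))‖ ≤ 1 := by
      rw [← Complex.ofReal_neg, Complex.norm_exp_ofReal, Real.exp_le_one_iff]
      linarith
    have hdec : Complex.exp (Complex.I * ↑(√(N : ℝ) * p)) * Complex.exp (-(Vx / 2 : ℝ))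
        - Complex.exp (Complex.I * ↑(√(N : ℝ) * empMean ψ x)) * Complex.exp (-(V / 2 : ℝ))
        = Complex.exp (Complex.I * ↑(√(N : ℝ) * p)) *
            (Complex.exp (-(Vx / 2 : ℝ)) - Complex.exp (-(V / 2 : ℝ)))
          + (Complex.exp (Complex.I * ↑(√(N : ℝ) * p))
            - Complex.exp (Complex.I * ↑(√(N : ℝ) * empMean ψ x))) *
            Complex.exp (-(V / 2 : ℝ)) := by ring
    have t1 : ‖Complex.exp (Complex.I * ↑(√(N : ℝ) * p)) * Complex.exp (-(Vx / 2 : ℝ))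
        - Complex.exp (Complex.I * ↑(√(N : ℝ) * empMean ψ x)) * Complex.exp (-(V / 2 : ℝ))‖
        ≤ |Vx - V| + |√(N : ℝ) * p - √(N : ℝ) * empMean ψ x| := by
      rw [hdec]
      refine (norm_add_le _ _).trans (add_le_add ?_ ?_)
      · rw [norm_mul, mul_comm Complex.I, Complex.norm_exp_ofReal_mul_I, one_mul]
        exact hexpV
      · rw [norm_mul]
        exact (mul_le_of_le_one_right (norm_nonneg _) hV1).trans (norm_cexp_I_mul_sub_le _ _)
    refine (norm_sub_le_norm_sub_add_norm_sub _ (Complex.exp (Complex.I * ↑(√(N : ℝ) * p))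
      * Complex.exp (-(Vx / 2 : ℝ))) _).trans ?_
    linarith
  have hi1 : Integrable (fun x : Fin N → E n =>
      (∫ y, Complex.exp (Complex.I * ↑((√(N : ℝ))⁻¹ * φ y)) ∂(S.PhiN n x)) ^ N) (μ n N) := by
    have hφm := hφ.1
    have hsm : StronglyMeasurable
        (fun y : E (n + 1) => Complex.exp (Complex.I * ↑((√(N : ℝ))⁻¹ * φ y))) := by
      refine Measurable.stronglyMeasurable ?_
      fun_prop
    have hk := hsm.integral_kernel
      (κ := ⟨_, S.measurable_PhiN hA1 hDom_convex hDom_range hA2 (n := n) hN⟩)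
    refine Integrable.of_bound (hk.pow N).aestronglyMeasurable 1 (ae_of_all _ fun x => ?_)
    have hpr := S.isProbabilityMeasure_PhiN hA1 hN x
    rw [norm_pow]
    refine pow_le_one₀ (norm_nonneg _) ?_
    refine (norm_integral_le_of_norm_le_const (C := 1) (ae_of_all _ fun y => ?_)).trans (by simp)
    rw [mul_comm, Complex.norm_exp_ofReal_mul_I]
  have hi2 : Integrable (fun x : Fin N → E n =>
      Complex.exp (Complex.I * ↑(√(N : ℝ) * empMean ψ x))) (μ n N) := by
    have hψm : Measurable (empMean ψ : (Fin N → E n) → ℝ) := measurable_empMean hψb.1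
    refine Integrable.of_bound (by fun_prop) 1 (ae_of_all _ fun x => ?_)
    rw [mul_comm, Complex.norm_exp_ofReal_mul_I]
  have hD := (hm.stat S hA1).integrable N hN
  have hWi := hW.integrable N hN
  have hi3 : Integrable (fun x : Fin N → E n =>
      ε * (1 + N * ‖empMean (S.stat n) x - S.limitParam n‖ ^ 2)) (μ n N) :=
    ((integrable_const _).add (hD.const_mul _)).const_mul _
  have hi4 : Integrable (fun x : Fin N → E n =>
      ε * (1 + N * ‖empMean (S.stat n) x - S.limitParam n‖ ^ 2)
          + √(N : ℝ) * (W₂ N x + W₃ N x + W₄ N x)) (μ n N) := hi3.add (hWi.const_mul _)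
  rw [hμ.integral_cexp_succ hA1 hDom_convex hDom_range hA2 hN hφ, ← integral_mul_const,
    ← integral_sub hi1 (hi2.mul_const _)]
  refine (norm_integral_le_of_norm_le ((integrable_const _).add hi4) (ae_of_all _ hpt)).trans ?_
  simp only [Pi.add_apply]
  rw [integral_add (integrable_const _) hi4, integral_add hi3 (hWi.const_mul _),
    integral_const_mul ε, integral_const_mul (√(N : ℝ)), integral_add (integrable_const _)
    (hD.const_mul _), integral_const_mul (N : ℝ)]
  simp only [integral_const, probReal_univ, one_smul]
  have f1 : (N : ℝ) * ∫ x, ‖empMean (S.stat n) x - S.limitParam n‖ ^ 2 ∂(μ n N) ≤ C₁ := by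
    have := mul_le_mul_of_nonneg_left (hC₁ N hN) hNr.le
    rwa [mul_div_cancel₀ _ hNr.ne'] at this
  have f2 : √(N : ℝ) * ∫ x, (W₂ N x + W₃ N x + W₄ N x) ∂(μ n N) ≤ C₂ * (√(N : ℝ))⁻¹ := by
    refine (mul_le_mul_of_nonneg_left (hC₂ N hN) hs.le).trans (le_of_eq ?_)
    have c2 : (N : ℝ)⁻¹ = (√(N : ℝ))⁻¹ * (√(N : ℝ))⁻¹ := by rw [← mul_inv, hss]
    rw [div_eq_mul_inv, c2]
    field_simp
  have f3 := mul_le_mul_of_nonneg_left f1 hε.le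
  nlinarith

/-- Central limit theorem for real test functions, in terms of characteristic functions. -/
theorem IsParticleLaw.tendsto_integral_cexp (n : ℕ) {φ : E n → ℝ} (hφ : BddMeas φ) :
    Tendsto (fun N : ℕ => ∫ x, Complex.exp (Complex.I *
        ↑(√(N : ℝ) * (empMean φ x - ∫ y, φ y ∂(S.eta n)))) ∂(μ n N)) atTop
      (𝓝 (Complex.exp (-(S.asympVar n φ / 2 : ℝ)))) := by
  have hinv : Tendsto (fun N : ℕ => (√(N : ℝ))⁻¹) atTop (𝓝 0) :=
    tendsto_inv_atTop_zero.comp (Real.tendsto_sqrt_atTop.comp tendsto_natCast_atTop_atTop)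
  induction n with
  | zero =>
    have := S.isProbabilityMeasure_eta hA1 0
    set c := ∫ y, φ y ∂(S.eta 0) with hc
    have hφc : BddMeas (fun y => φ y - c) := hφ.sub_const c
    obtain ⟨K, hK⟩ := hφc.2
    have hc0 : ∫ y, (φ y - c) ∂(S.eta 0) = 0 := by
      rw [integral_sub (hφ.integrable _) (integrable_const _)]
      simp [hc]
    have hlim := hinv.mul_const
      ((2 * K) ^ 3 * Real.exp (2 * K) + (2 * K) ^ 4 * Real.exp ((2 * K) ^ 2))
    rw [zero_mul] at hlim
    rw [tendsto_iff_norm_sub_tendsto_zero]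
    refine squeeze_zero' (Eventually.of_forall fun _ => norm_nonneg _) ?_ hlim
    filter_upwards [eventually_gt_atTop 0] with N hN
    have h := norm_integral_cexp_pow_sub_le (ν := S.eta 0) hφc.1 hK hN
    rw [hc0, ← integral_cexp_empMean hN] at h
    simp only [empMean_sub_const hN, sub_zero, mul_zero, Complex.ofReal_zero, Complex.exp_zero,
      one_mul] at h
    rw [hμ.zero, ← eta_zero]
    exact h
  | succ n ih =>
    have := S.isProbabilityMeasure_eta hA1 (n + 1)
    set c := ∫ y, φ y ∂(S.eta (n + 1)) with hc
    have hφc : BddMeas (fun y => φ y - c) := hφ.sub_const c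
    have hc0 : ∫ y, (φ y - c) ∂(S.eta (n + 1)) = 0 := by
      rw [integral_sub (hφ.integrable _) (integrable_const _)]
      simp [hc]
    set ψ : E n → ℝ := fun x => (∫ z, S.limG n z ∂(S.eta n))⁻¹ * S.L n (fun y => φ y - c) x
      with hψ
    have hψb : BddMeas ψ := (S.bddMeas_L hA1 hφc).const_mul _
    have hψ0 : ∫ x, ψ x ∂(S.eta n) = 0 := by
      rw [hψ, integral_const_mul, S.integral_L hA1 hφc hc0, mul_zero]
    -- `ψ` is already centred under `η_n`, so the hypothesis at time `n` applies to its bare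
    -- empirical mean.
    have hIH := ih hψb
    simp only [hψ0, sub_zero] at hIH
    set V := ∫ y, (φ y - c) ^ 2 ∂(S.eta (n + 1)) with hV
    have hlim := hIH.mul_const (Complex.exp (-(V / 2 : ℝ)))
    have hval : Complex.exp (-(S.asympVar n ψ / 2 : ℝ)) * Complex.exp (-(V / 2 : ℝ))
        = Complex.exp (-(S.asympVar (n + 1) φ / 2 : ℝ)) := by
      rw [← Complex.exp_add]
      congr 1
      simp only [asympVar]
      push_cast
      ring
    rw [hval] at hlim
    obtain ⟨C₁, hC₁⟩ := hμ.norm_integral_cexp_succ_sub_le hA1 hDom_convex hDom_range hA2 hφc hc0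
    have hdiff : Tendsto (fun N : ℕ =>
        ∫ y, Complex.exp (Complex.I * ↑(√(N : ℝ) * (empMean φ y - c))) ∂(μ (n + 1) N)
        - (∫ x, Complex.exp (Complex.I * ↑(√(N : ℝ) * empMean ψ x)) ∂(μ n N))
          * Complex.exp (-(V / 2 : ℝ))) atTop (𝓝 0) := by
      rw [Metric.tendsto_atTop']
      intro η hη
      -- This `ε` makes `ε * C₁ ≤ η / 2` whatever the sign of `C₁`; the other half comes from `N`
      -- large.
      obtain ⟨C₂, hC₂⟩ := hC₁ (η / (2 * (|C₁| + 1))) (by positivity)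
      have h2 := (hinv.const_mul C₂).eventually_lt_const (u := η / 2)
        (by rw [mul_zero]; exact half_pos hη)
      obtain ⟨N₀, hN₀⟩ := eventually_atTop.1 (h2.and (eventually_gt_atTop 0))
      refine ⟨N₀, fun N hN => ?_⟩
      obtain ⟨h3, hNpos⟩ := hN₀ N hN.le
      have h4 := hC₂ N hNpos
      simp only [empMean_sub_const hNpos] at h4
      rw [dist_zero_right]
      have h5 : η / (2 * (|C₁| + 1)) * C₁ ≤ η / 2 := by
        rw [div_mul_eq_mul_div, div_le_div_iff₀ (by positivity) two_pos]
        nlinarith [le_abs_self C₁, abs_nonneg C₁]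
      exact h4.trans_lt (by linarith)
    have := hdiff.add hlim
    simpa using this

end CLT
end AdaptiveSMC

/-! ### Covariance matrices as quadratic forms -/

section covMatrix

variable {α : Type*} [MeasurableSpace α] {r : ℕ} (ν : Measure α) [IsProbabilityMeasure ν]
  {φ : α → EuclideanSpace ℝ (Fin r)}

lemma covMatrix_sub_const (hφ : BddMeas φ) (c : EuclideanSpace ℝ (Fin r)) :
    covMatrix ν (fun x => φ x - c) = covMatrix ν φ := by
  unfold covMatrix
  rw [integral_sub (hφ.integrable ν) (integrable_const _)]
  simp

open Matrix in
lemma dotProduct_covMatrix_mulVec (hφ : BddMeas φ) (t : EuclideanSpace ℝ (Fin r)) :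
    t ⬝ᵥ covMatrix ν φ *ᵥ t
      = ∫ x, (inner ℝ t (φ x) - ∫ y, inner ℝ t (φ y) ∂ν) ^ 2 ∂ν := by
  set c := ∫ y, φ y ∂ν with hc
  have hb : BddMeas (fun x => φ x - c) := hφ.sub_const c
  have h1 : ∫ y, inner ℝ t (φ y) ∂ν = inner ℝ t c :=
    (innerSL ℝ t).integral_comp_comm (hφ.integrable ν)
  have hbi : ∀ i, BddMeas (fun x => (φ x - c) i) := fun i =>
    hb.clm_comp (EuclideanSpace.proj i : EuclideanSpace ℝ (Fin r) →L[ℝ] ℝ)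
  have hij : ∀ i j, Integrable (fun x => (φ x - c) i * (φ x - c) j) ν := by
    intro i j
    obtain ⟨C, hC⟩ := (hbi j).2
    exact ((hbi i).integrable ν).mul_bdd (hbi j).1.aestronglyMeasurable (ae_of_all _ hC)
  have h2 : ∀ x, (inner ℝ t (φ x) - inner ℝ t c) ^ 2
      = ∑ i, ∑ j, t i * t j * ((φ x - c) i * (φ x - c) j) := by
    intro x
    rw [← inner_sub_right, PiLp.inner_apply, sq, Finset.sum_mul_sum]
    refine Finset.sum_congr rfl fun i _ => Finset.sum_congr rfl fun j _ => ?_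
    simp only [RCLike.inner_apply, conj_trivial]
    ring
  rw [h1]
  simp_rw [h2]
  rw [integral_finsetSum _ fun i _ => integrable_finsetSum _ fun j _ => (hij i j).const_mul _]
  simp only [dotProduct, mulVec, covMatrix, Matrix.of_apply, ← hc]
  refine Finset.sum_congr rfl fun i _ => ?_
  rw [integral_finsetSum _ fun j _ => (hij i j).const_mul _, Finset.mul_sum]
  refine Finset.sum_congr rfl fun j _ => ?_
  rw [integral_const_mul]
  ring

lemma posSemidef_covMatrix (hφ : BddMeas φ) : (covMatrix ν φ).PosSemidef := by
  refine Matrix.PosSemidef.of_dotProduct_mulVec_nonneg ?_ fun t => ?_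
  · ext i j
    simp [covMatrix, mul_comm]
  · have h := dotProduct_covMatrix_mulVec ν hφ (WithLp.toLp 2 t)
    rw [star_trivial]
    refine le_of_le_of_eq ?_ h.symm
    exact integral_nonneg fun x => sq_nonneg _

end covMatrix

/-! ### The asymptotic covariance and its recursion -/

namespace AdaptiveSMC

variable {d : ℕ} {E : ℕ → Type*} [∀ n, MeasurableSpace (E n)]

section Cov

variable {r : ℕ} (S : AdaptiveSMC d E)

lemma Lcomp_self {F : Type*} [NormedAddCommGroup F] [NormedSpace ℝ F] (n : ℕ) (φ : E n → F) :
    S.Lcomp le_rfl φ = φ :=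
  Nat.decreasingInduction_self _ _

lemma Lcomp_succ {F : Type*} [NormedAddCommGroup F] [NormedSpace ℝ F] {p n : ℕ} (h : p ≤ n)
    (h' : p ≤ n + 1) (φ : E (n + 1) → F) : S.Lcomp h' φ = S.Lcomp h (S.L n φ) :=
  Nat.decreasingInduction_succ _ _ h h'

variable (hA1 : S.HypContinuity)

include hA1

lemma bddMeas_Lcomp {p n : ℕ} (h : p ≤ n) {φ : E n → EuclideanSpace ℝ (Fin r)}
    (hφ : BddMeas φ) : BddMeas (S.Lcomp h φ) := by
  induction n with
  | zero =>
    obtain rfl : p = 0 := by omega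
    rwa [Lcomp_self]
  | succ n ih =>
    rcases Nat.lt_or_ge n p with hp | hp
    · obtain rfl : p = n + 1 := by omega
      rwa [Lcomp_self]
    · rw [S.Lcomp_succ hp]
      exact ih hp (S.bddMeas_L hA1 hφ)

lemma gamma_real_pos (n : ℕ) : 0 < (S.gamma n).real Set.univ := by
  obtain ⟨h1, h2⟩ := S.gamma_univ_pos_lt_top hA1 n
  exact ENNReal.toReal_pos h1.ne' h2.ne

lemma posSemidef_asympCov (n : ℕ) {φ : E n → EuclideanSpace ℝ (Fin r)} (hφ : BddMeas φ) :
    (S.asympCov n φ).PosSemidef := by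
  unfold asympCov
  refine Matrix.posSemidef_sum _ fun p _ => ?_
  have := S.isProbabilityMeasure_eta hA1 p
  exact (posSemidef_covMatrix _ (S.bddMeas_Lcomp hA1 _ (hφ.sub_const _))).smul (by positivity)

lemma asympCov_zero {φ : E 0 → EuclideanSpace ℝ (Fin r)} (hφ : BddMeas φ) :
    S.asympCov 0 φ = covMatrix (S.eta 0) φ := by
  have := S.isProbabilityMeasure_eta hA1 0
  have hg := S.gamma_real_pos hA1 0
  refine (Fin.sum_univ_one _).trans ?_
  rw [← covMatrix_sub_const _ hφ (∫ y, φ y ∂(S.eta 0))]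
  change ((S.gamma 0).real Set.univ ^ 2 / (S.gamma 0).real Set.univ ^ 2) •
    covMatrix (S.eta 0) (S.Lcomp le_rfl _) = _
  rw [Lcomp_self, div_self (by positivity), one_smul]

/-- Recursion for the asymptotic covariance. -/
theorem asympCov_succ (n : ℕ) {φ : E (n + 1) → EuclideanSpace ℝ (Fin r)} (hφ : BddMeas φ) :
    S.asympCov (n + 1) φ = covMatrix (S.eta (n + 1)) φ +
      ((∫ x, S.limG n x ∂(S.eta n)) ^ 2)⁻¹ •
        S.asympCov n (S.L n (fun x => φ x - ∫ y, φ y ∂(S.eta (n + 1)))) := by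
  have := S.isProbabilityMeasure_eta hA1 (n + 1)
  have hg := S.gamma_real_pos hA1 (n + 1)
  set c := ∫ y, φ y ∂(S.eta (n + 1)) with hc
  have hφc : BddMeas (fun y => φ y - c) := hφ.sub_const c
  have hc0 : ∫ y, (φ y - c) ∂(S.eta (n + 1)) = 0 := by
    rw [integral_sub (hφ.integrable _) (integrable_const _)]
    simp [hc]
  have hlast : ((S.gamma (n + 1)).real Set.univ ^ 2 / (S.gamma (n + 1)).real Set.univ ^ 2) •
      covMatrix (S.eta (n + 1)) (S.Lcomp le_rfl (fun x => φ x - c))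
      = covMatrix (S.eta (n + 1)) φ := by
    rw [Lcomp_self, div_self (by positivity), one_smul, covMatrix_sub_const _ hφ]
  -- `asympCov` at time `n` subtracts the mean of its argument, which is zero here.
  simp only [asympCov, S.integral_L hA1 hφc hc0, sub_zero, ← hc]
  rw [Fin.sum_univ_castSucc, add_comm]
  congr 1
  rw [Finset.smul_sum]
  refine Finset.sum_congr rfl fun p _ => ?_
  have hp : (p : ℕ) ≤ n := Nat.lt_succ_iff.1 p.2
  simp only [Fin.val_castSucc]
  -- The identity `γ_{n+1}(1) = γ_n(1) η_n(G_n)` converts the weights of one time into those of the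
  -- next.
  rw [S.Lcomp_succ hp, smul_smul, S.gamma_real_succ hA1]
  congr 1
  rw [mul_pow]
  have h1 := S.gamma_real_pos hA1 n
  have h2 : 0 < ∫ x, S.limG n x ∂(S.eta n) := by
    have := S.isProbabilityMeasure_eta hA1 n
    exact S.integral_G_pos hA1 _ _
  field_simp

variable {Dom : ℕ → Set (EuclideanSpace ℝ (Fin d))} (hDom_convex : ∀ n, Convex ℝ (Dom n))
  (hDom_range : ∀ n, Set.range (S.stat n) ⊆ Dom n) (hA2 : S.HypDifferentiability Dom)

include hDom_convex hDom_range hA2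

-- Both sides obey the same backward recursion, once linear functionals are moved through `𝓛`.
open Matrix in
lemma dotProduct_asympCov_mulVec (n : ℕ) {φ : E n → EuclideanSpace ℝ (Fin r)} (hφ : BddMeas φ)
    (t : EuclideanSpace ℝ (Fin r)) :
    t ⬝ᵥ S.asympCov n φ *ᵥ t = S.asympVar n (fun x => inner ℝ t (φ x)) := by
  induction n generalizing t with
  | zero =>
    have := S.isProbabilityMeasure_eta hA1 0
    rw [S.asympCov_zero hA1 hφ, dotProduct_covMatrix_mulVec _ hφ]
    rfl
  | succ n ih =>
    have := S.isProbabilityMeasure_eta hA1 (n + 1)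
    have hmem := S.limitParam_mem hA1 n (hDom_convex n) (hDom_range n)
    have hφc : BddMeas (fun y => φ y - ∫ z, φ z ∂(S.eta (n + 1))) := hφ.sub_const _
    rw [S.asympCov_succ hA1 n hφ, add_mulVec, dotProduct_add, dotProduct_covMatrix_mulVec _ hφ,
      asympVar]
    congr 1
    set a := ∫ x, S.limG n x ∂(S.eta n)
    -- The normalisation `a⁻¹` sits in the test function for `asympVar` and outside the matrix,
    -- squared, for `asympCov`. Rescaling the direction `t` reconciles them, hence the
    -- generalization over `t`.
    have h1 := ih (S.bddMeas_L hA1 hφc) (a⁻¹ • t)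
    have h2 : ∫ z, inner ℝ t (φ z) ∂(S.eta (n + 1)) = inner ℝ t (∫ z, φ z ∂(S.eta (n + 1))) :=
      (innerSL ℝ t).integral_comp_comm (hφ.integrable _)
    have h3 : ∀ x, a⁻¹ * S.L n (fun y => inner ℝ t (φ y) - ∫ z, inner ℝ t (φ z) ∂(S.eta (n + 1))) x
        = inner ℝ (a⁻¹ • t) (S.L n (fun y => φ y - ∫ z, φ z ∂(S.eta (n + 1))) x) := by
      intro x
      rw [real_inner_smul_left]
      congr 1
      rw [h2]
      simp_rw [← inner_sub_right]
      exact S.L_clm_comp hA1 hA2 hmem hφc (innerSL ℝ t) x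
    simp_rw [h3]
    rw [← h1, smul_mulVec, dotProduct_smul, WithLp.ofLp_smul]
    simp only [mulVec_smul, dotProduct_smul, smul_dotProduct, smul_eq_mul]
    ring

end Cov

end AdaptiveSMC

/-! ### The central limit theorem for vector-valued test functions -/

theorem mainTheorem2 {d : ℕ} {E : ℕ → Type*} [∀ n, MeasurableSpace (E n)]
    (S : AdaptiveSMC d E)
    (Dom : ℕ → Set (EuclideanSpace ℝ (Fin d)))
    (hDom_convex : ∀ n, Convex ℝ (Dom n))
    (hDom_range : ∀ n, Set.range (S.stat n) ⊆ Dom n)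
    (hA1 : S.HypContinuity) (hA2 : S.HypDifferentiability Dom)
    {Ω : ℕ → Type*} [∀ N, MeasurableSpace (Ω N)]
    (P : ∀ N, Measure (Ω N)) [∀ N, IsProbabilityMeasure (P N)]
    (X : ∀ N n, Fin N → Ω N → E n)
    (hX : ∀ N, S.IsParticleSystem N (P N) (X N))
    (r : ℕ) :
    (∀ (n : ℕ) (φ : E n → EuclideanSpace ℝ (Fin r)), BddMeas φ →
      (S.asympCov n φ).PosSemidef ∧
      TendstoInDistribution
        (fun (N : ℕ) ω => √(N : ℝ) •
          (∫ x, φ x ∂(empirical fun i => X N n i ω) - ∫ x, φ x ∂(S.eta n)))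
        atTop id P (multivariateGaussian 0 (S.asympCov n φ))) ∧
    (∀ (n : ℕ) (φ : E (n + 1) → EuclideanSpace ℝ (Fin r)), BddMeas φ →
      S.asympCov (n + 1) φ = covMatrix (S.eta (n + 1)) φ +
        ((∫ x, S.limG n x ∂(S.eta n)) ^ 2)⁻¹ •
          S.asympCov n (S.L n (fun x => φ x - ∫ y, φ y ∂(S.eta (n + 1))))) := by
  refine ⟨fun n φ hφ => ⟨S.posSemidef_asympCov hA1 n hφ, ?_⟩,
    fun n φ hφ => S.asympCov_succ hA1 n hφ⟩
  have hXm : ∀ N k, Measurable (fun ω i => X N k i ω) := fun N k =>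
    measurable_pi_lambda _ fun i => (hX N).measurable k i
  -- From here on only the laws of the particle vectors matter, so the probability spaces may vary
  -- with `N`.
  have hμ : S.IsParticleLaw (fun k N => (P N).map (fun ω i => X N k i ω)) :=
    ⟨fun k N => Measure.isProbabilityMeasure_map (hXm N k).aemeasurable, fun N => (hX N).init,
      fun k N hN => AdaptiveSMC.IsParticleSystem.map_succ S hA1 hDom_convex hDom_range hA2
        (hX N) hN k⟩
  have := S.isProbabilityMeasure_eta hA1 n
  simp_rw [integral_empirical hφ.1.stronglyMeasurable]
  set c := ∫ x, φ x ∂(S.eta n) with hc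
  have hem : ∀ N, Measurable (empMean φ : (Fin N → E n) → _) := fun N => measurable_empMean hφ.1
  have hmeas : ∀ N : ℕ, Measurable (fun ω => √(N : ℝ) • (empMean φ (fun i => X N n i ω) - c)) :=
    fun N => Measurable.const_smul (((hem N).comp (hXm N n)).sub_const c) (√(N : ℝ))
  refine ⟨fun N => (hmeas N).aemeasurable, aemeasurable_id, ?_⟩
  -- Lévy's continuity theorem: the characteristic function at `t` is the scalar one for the test
  -- function `⟨t, φ⟩`.
  refine ProbabilityMeasure.tendsto_iff_tendsto_charFun.2 fun t => ?_
  have hφt : BddMeas (fun x => inner ℝ t (φ x)) := hφ.clm_comp (innerSL ℝ t)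
  have hct : ∫ x, inner ℝ t (φ x) ∂(S.eta n) = inner ℝ t c :=
    (innerSL ℝ t).integral_comp_comm (hφ.integrable _)
  have hlim := hμ.tendsto_integral_cexp hA1 hDom_convex hDom_range hA2 n hφt
  rw [hct] at hlim
  have hR : charFun ((multivariateGaussian 0 (S.asympCov n φ)).map id) t
      = Complex.exp (-(S.asympVar n (fun x => inner ℝ t (φ x)) / 2 : ℝ)) := by
    rw [Measure.map_id, charFun_multivariateGaussian (S.posSemidef_asympCov hA1 n hφ),
      ← S.dotProduct_asympCov_mulVec hA1 hDom_convex hDom_range hA2 n hφ]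
    congr 1
    simp
  have hLft : ∀ N : ℕ, charFun ((P N).map
        (fun ω => √(N : ℝ) • (empMean φ (fun i => X N n i ω) - c))) t
      = ∫ x, Complex.exp (Complex.I * ↑(√(N : ℝ) *
        (empMean (fun y => inner ℝ t (φ y)) x - inner ℝ t c)))
          ∂((P N).map (fun ω i => X N n i ω)) := by
    intro N
    have hem' : Measurable (empMean (fun y => inner ℝ t (φ y)) : (Fin N → E n) → ℝ) :=
      measurable_empMean hφt.1
    rw [charFun_apply, integral_map (hmeas N).aemeasurable (by fun_prop),
      integral_map (hXm N n).aemeasurable (by fun_prop)]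
    congr 1
    funext ω
    have h := map_empMean (innerSL ℝ t).toLinearMap φ (fun i => X N n i ω)
    simp only [ContinuousLinearMap.coe_coe, innerSL_apply_apply] at h
    rw [real_inner_comm, real_inner_smul_right, inner_sub_right, h, mul_comm Complex.I]
  exact (hlim.congr fun N => (hLft N).symm).trans_eq (congrArg 𝓝 hR.symm)

end
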